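/- **Setting.** A DNN has partition points $\mathcal P=\{0,1,\dots,P\}$, $P\ge 1$, where $p=P$ means pure on-device processing. Point $p$ has a known front-end delay $d^{\mathrm f}_p\in\mathbb R$ and a known context $x_p\in\mathbb R^d$, with $x_P=0$. The expected delay of $p$ is $D_p=d^{\mathrm f}_p+\theta^{*\top}x_p$ with $\theta^*\in\mathbb R^d$ unknown. Assume $\|\theta^*\|_2\le C_\theta$, $\|x_p\|_2\le C_x$ and $|D_p-D_P|\le\Delta$ for all $p$. In frame $t$, after choosing $p_t\ne P$, the learner observes $y_t=\theta^{*\top}x_{p_t}+\eta_t$. The noise $\eta_t$ is conditionally $C_\eta$-sub-Gaussian given the past $\mathcal H_{t-1}$: $\mathbb E[e^{s\eta_t}\mid\mathcal H_{t-1}]\le e^{s^2C_\eta^2/2}$ for all $s\in\mathbb R$. Frame $t$ has a weight $L_t\in\{L_{\text{non-key}},L_{\text{key}}\}$ known before the decision, where $0<L_{\text{non-key}}<L_{\text{key}}<1$. Let $\beta\ge\max\{1,C_\theta^2\}$. **Algorithm ($\mu$LinUCB, horizon $T\ge1$, confidence $\delta\in(0,1)$, parameter $\mu\ge 0$).** Put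 $$\alpha=\frac{\sqrt\beta\,C_\theta+C_\eta\sqrt{\max\{d,2\}\,\log\frac{1+TC_x^2}{\delta}}}{1-L_{\text{key}}},$$ $A_0=\beta I_d$, $b_0=0$, and let $\mathcal F$ be the set of frames $t\le T$ of the form $t=nT^\mu$, $n=1,2,\dots$ (where $nT^\mu$ is rounded to an integer by any fixed rule that moves a number by less than $1$). In frame $t=1,\dots,T$ let $\hat\theta_t=A_{t-1}^{-1}b_{t-1}$ and let $p_t$ be a minimizer of $$d^{\mathrm f}_p+\hat\theta_t^\top x_p-\alpha\sqrt{(1-L_t)\,x_p^\top A_{t-1}^{-1}x_p}$$ over $p\in\mathcal P\setminus\{P\}$ if $t\in\mathcal F$, and over $p\in\mathcal P$ otherwise (ties are broken in any way that depends only on the past). If $p_t\neq P$, put $A_t=A_{t-1}+x_{p_t}x_{p_t}^\top$ and $b_t=b_{t-1}+y_t\,x_{p_t}$; otherwise $A_t=A_{t-1}$ and $b_t=b_{t-1}$. **Theorem.** There is a constant $C>0$ that depends only on $d,C_\theta,C_\eta,C_x,L_{\text{key}},\beta,\Delta$, such that for all $T\ge1$, $\mu\ge0$ and $\delta\in(0,1)$,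 with probability at least $1-\delta$, the regret against the oracle that always uses the best partition point satisfies $$R(T)=\sum_{t=1}^T\Bigl(D_{p_t}-\min_{p\in\mathcal P}D_p\Bigr)\le C\,B_{\mu,\delta}(T),\qquad B_{\mu,\delta}(T)=\max\bigl\{T^{1/2+\mu}\log(T/\delta),\;T^{1-\mu}\bigr\}.$$ Moreover, for fixed $\delta\in(0,1)$, the bound is sublinear for $\mu\in(0,\tfrac12)$, that is, $B_{\mu,\delta}(T)/T\to0$ as $T\to\infty$. For $\mu=\tfrac14$ it is $O(T^{3/4}\log T)$, and this order is the smallest possible: $B_{1/4,\delta}(T)=o(B_{\mu,\delta}(T))$ for every $\mu\ne\tfrac14$. -/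

import Mathlib

open MeasureTheory Filter Topology Asymptotics

namespace MuLinUCB

noncomputable section

/-- Expected end-to-end delay of partition point `p`: the known front-end delay plus the linear
edge offloading delay. The partition points are `0, …, P`, and `Fin.last P` is pure on-device
processing. -/
def expectedDelay {d P : ℕ} (df : Fin (P + 1) → ℝ) (θ : EuclideanSpace ℝ (Fin d))
    (x : Fin (P + 1) → EuclideanSpace ℝ (Fin d)) (p : Fin (P + 1)) : ℝ :=
  df p + inner ℝ θ (x p)

/-- Delay of the oracle, which always uses the best partition point. -/
def oracleDelay {d P : ℕ} (df : Fin (P + 1) → ℝ) (θ : EuclideanSpace ℝ (Fin d))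
    (x : Fin (P + 1) → EuclideanSpace ℝ (Fin d)) : ℝ :=
  Finset.univ.inf' Finset.univ_nonempty (expectedDelay df θ x)

/-- Regret over the frames `1, …, T` of the decisions `p 1, …, p T`. -/
def regret {d P : ℕ} (df : Fin (P + 1) → ℝ) (θ : EuclideanSpace ℝ (Fin d))
    (x : Fin (P + 1) → EuclideanSpace ℝ (Fin d)) (p : ℕ → Fin (P + 1)) (T : ℕ) : ℝ :=
  ∑ t ∈ Finset.Icc 1 T, (expectedDelay df θ x (p t) - oracleDelay df θ x)

/-- The matrix `A_t`: `A_0 = β I`, and `x xᵀ` is added after each frame that is not processed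
purely on the device. -/
def matA {d P : ℕ} (β : ℝ) (x : Fin (P + 1) → EuclideanSpace ℝ (Fin d))
    (p : ℕ → Fin (P + 1)) : ℕ → Matrix (Fin d) (Fin d) ℝ
  | 0 => β • (1 : Matrix (Fin d) (Fin d) ℝ)
  | t + 1 =>
    if p (t + 1) = Fin.last P then matA β x p t
    else matA β x p t + Matrix.vecMulVec (x (p (t + 1))).ofLp (x (p (t + 1))).ofLp

/-- The vector `b_t`: `b_0 = 0`, and `x · y_t` is added after each frame that is not processed
purely on the device, where `y t` is the edge offloading delay observed in frame `t`. -/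
def vecB {d P : ℕ} (x : Fin (P + 1) → EuclideanSpace ℝ (Fin d))
    (p : ℕ → Fin (P + 1)) (y : ℕ → ℝ) : ℕ → (Fin d → ℝ)
  | 0 => 0
  | t + 1 =>
    if p (t + 1) = Fin.last P then vecB x p y t
    else vecB x p y t + y (t + 1) • (x (p (t + 1))).ofLp

/-- The ridge estimate `A_t⁻¹ b_t` that is used in frame `t + 1`. -/
def thetaHat {d P : ℕ} (β : ℝ) (x : Fin (P + 1) → EuclideanSpace ℝ (Fin d))
    (p : ℕ → Fin (P + 1)) (y : ℕ → ℝ) (t : ℕ) : Fin d → ℝ :=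
  Matrix.mulVec (matA β x p t)⁻¹ (vecB x p y t)

/-- The quantity that is minimized over partition points `q` in frame `t + 1`: front-end delay
plus estimated edge delay minus the confidence width, which is scaled with the frame weight. -/
def score {d P : ℕ} (α β : ℝ) (df : Fin (P + 1) → ℝ)
    (x : Fin (P + 1) → EuclideanSpace ℝ (Fin d)) (L : ℕ → ℝ)
    (p : ℕ → Fin (P + 1)) (y : ℕ → ℝ) (t : ℕ) (q : Fin (P + 1)) : ℝ :=
  df q + dotProduct (thetaHat β x p y t) (x q).ofLp
    - α * √((1 - L (t + 1)) *
        dotProduct (x q).ofLp (Matrix.mulVec (matA β x p t)⁻¹ (x q).ofLp))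

/-- `ρ` rounds every nonnegative real to a neighbouring natural number (so it fixes the natural
numbers); the floor, the ceiling and the nearest integer are examples. -/
def IsRounding (ρ : ℝ → ℕ) : Prop :=
  ∀ y : ℝ, 0 ≤ y → |(ρ y : ℝ) - y| < 1

/-- The forced sampling frames `n T^μ ≤ T`, `n = 1, 2, …`, rounded to integers by `ρ`. -/
def forcedFrames (ρ : ℝ → ℕ) (μ : ℝ) (T : ℕ) : Set ℕ :=
  {t | t ≤ T ∧ ∃ n : ℕ, 1 ≤ n ∧ t = ρ ((n : ℝ) * (T : ℝ) ^ μ)}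

/-- `p 1, …, p T` are decisions that the algorithm with forced sampling frames `F`, frame
weights `L` and observed edge delays `y` can take: in a frame of `F` a minimizer of the score
among the points different from `Fin.last P`, in every other frame a minimizer among all points.
Ties may be broken in any way. -/
structure IsRun {d P : ℕ} (T : ℕ) (F : Set ℕ) (α β : ℝ) (df : Fin (P + 1) → ℝ)
    (x : Fin (P + 1) → EuclideanSpace ℝ (Fin d)) (L : ℕ → ℝ) (y : ℕ → ℝ)
    (p : ℕ → Fin (P + 1)) : Prop where
  forced : ∀ t < T, t + 1 ∈ F → p (t + 1) ≠ Fin.last P ∧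
    ∀ q, q ≠ Fin.last P → score α β df x L p y t (p (t + 1)) ≤ score α β df x L p y t q
  regular : ∀ t < T, t + 1 ∉ F →
    ∀ q, score α β df x L p y t (p (t + 1)) ≤ score α β df x L p y t q

/-- The noise `η 1, …, η T` is adapted to the filtration and conditionally `σ`-sub-Gaussian:
`E[exp (s η_{t+1}) | ℱ_t] ≤ exp (s² σ² / 2)` almost surely, for every real `s`. -/
structure IsSubGaussianNoise {Ω : Type*} {mΩ : MeasurableSpace Ω} (ℙ : Measure Ω)
    (ℱ : Filtration ℕ mΩ) (σ : ℝ) (T : ℕ) (η : ℕ → Ω → ℝ) : Prop where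
  adapted : ∀ t < T, Measurable[ℱ (t + 1)] (η (t + 1))
  integrable_exp : ∀ t < T, ∀ s : ℝ, Integrable (fun ω => Real.exp (s * η (t + 1) ω)) ℙ
  condExp_exp_le : ∀ t < T, ∀ s : ℝ,
    ℙ[fun ω => Real.exp (s * η (t + 1) ω) | ℱ t] ≤ᵐ[ℙ] fun _ => Real.exp (s ^ 2 * σ ^ 2 / 2)

/-- The exploration parameter `α` of the algorithm for horizon `T` and confidence `δ`. -/
def explorationParam (d : ℕ) (Cθ Cη Cx Lkey β : ℝ) (T : ℕ) (δ : ℝ) : ℝ :=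
  (√β * Cθ + Cη * √(max (d : ℝ) 2 * Real.log ((1 + T * Cx ^ 2) / δ))) / (1 - Lkey)

/-- The order `max {T^(1/2 + μ) log (T / δ), T^(1 - μ)}` of the regret bound. -/
def regretRate (μ δ : ℝ) (T : ℕ) : ℝ :=
  max ((T : ℝ) ^ (1 / 2 + μ) * Real.log (T / δ)) ((T : ℝ) ^ (1 - μ))

end

end MuLinUCB

/-! The regret splits into two costs. A forced frame costs at most `2Δ`, by comparison with
on-device processing, and there are at most `2 T^(1-μ)` such frames. Elsewhere the choice is
optimistic. Let the width of `q` be the norm of `x q` with respect to `A_t⁻¹`, and let `α = κ / (1 -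
Lkey)`. If every estimated edge delay is within `κ` widths of the true one, the frame costs at most
`2α` widths of the chosen point. The elliptical potential lemma (`sum_widthSq_le`) bounds the sum of
the squared widths logarithmically in `T`; Cauchy–Schwarz and the size `√(log (T/δ))` of `α` then
give the order `√T log (T/δ)`.

Probability enters only through the estimation error, which is `A_t⁻¹ S_t` minus a ridge bias, with
`S_t` the weighted noise sum. The norm of `S_t` must be controlled for all `t ≤ T` at once. This is
the method of mixtures: `mixtureProcess` is a nonnegative supermartingale that starts at `1`, so
Ville's inequality keeps it below `1/δ` outside an event of probability `δ`. Each step of it is a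
one-dimensional Gaussian average of exponential supermartingale increments whose slope has a mean
and a variance fixed by the past, so no `d`-dimensional integral is needed.

The rate claims reflect that the exponents `1/2 + μ` and `1 - μ` cross at `μ = 1/4`. -/

namespace MuLinUCB

open Matrix
open scoped ENNReal

/-! ### Rank-one updates and the quadratic form of the inverse. -/

section LinearAlgebra

variable {n : Type*} [Fintype n]

theorem vecMulVec_mulVec_self (z w : n → ℝ) : vecMulVec z z *ᵥ w = (z ⬝ᵥ w) • z := by
  ext i
  simp [vecMulVec_mulVec, mul_comm]

theorem dotProduct_add_vecMulVec_mulVec (A : Matrix n n ℝ) (z w : n → ℝ) :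
    w ⬝ᵥ ((A + vecMulVec z z) *ᵥ w) = w ⬝ᵥ (A *ᵥ w) + (z ⬝ᵥ w) ^ 2 := by
  rw [add_mulVec, vecMulVec_mulVec_self, dotProduct_add, dotProduct_smul, smul_eq_mul,
    dotProduct_comm w z, sq]

theorem posDef_add_vecMulVec {A : Matrix n n ℝ} (hA : A.PosDef) (z : n → ℝ) :
    (A + vecMulVec z z).PosDef := by
  have h := posSemidef_vecMulVec_self_star z
  rw [star_trivial] at h
  exact hA.add_posSemidef h

variable [DecidableEq n]

theorem PosDef.mul_inv {A : Matrix n n ℝ} (hA : A.PosDef) : A * A⁻¹ = 1 :=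
  mul_nonsing_inv A ((isUnit_iff_isUnit_det A).1 hA.isUnit)

theorem PosDef.inv_mul {A : Matrix n n ℝ} (hA : A.PosDef) : A⁻¹ * A = 1 :=
  nonsing_inv_mul A ((isUnit_iff_isUnit_det A).1 hA.isUnit)

theorem PosDef.dotProduct_inv_nonneg {A : Matrix n n ℝ} (hA : A.PosDef) (z : n → ℝ) :
    0 ≤ z ⬝ᵥ (A⁻¹ *ᵥ z) := by
  simpa using hA.inv.posSemidef.dotProduct_mulVec_nonneg z

theorem PosDef.dotProduct_inv_comm {A : Matrix n n ℝ} (hA : A.PosDef) (y z : n → ℝ) :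
    y ⬝ᵥ (A⁻¹ *ᵥ z) = z ⬝ᵥ (A⁻¹ *ᵥ y) := by
  have h : (A⁻¹)ᵀ = A⁻¹ := by simpa using hA.inv.isHermitian.eq
  rw [dotProduct_mulVec, ← mulVec_transpose, h, dotProduct_comm]

theorem det_add_vecMulVec {A : Matrix n n ℝ} (hA : A.PosDef) (z : n → ℝ) :
    (A + vecMulVec z z).det = A.det * (1 + z ⬝ᵥ (A⁻¹ *ᵥ z)) := by
  have h := det_add_replicateCol_mul_replicateRow (ι := Unit)
    ((isUnit_iff_isUnit_det A).1 hA.isUnit) z z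
  rw [← vecMulVec_eq] at h
  rw [h]
  congr 2
  simp [Matrix.mul_apply, dotProduct, mulVec, Finset.mul_sum, Finset.sum_mul]
  rw [Finset.sum_comm]
  simp only [mul_assoc]

theorem dotProduct_inv_add_vecMulVec {A : Matrix n n ℝ} (hA : A.PosDef) (z S : n → ℝ) (η : ℝ) :
    (S + η • z) ⬝ᵥ ((A + vecMulVec z z)⁻¹ *ᵥ (S + η • z)) =
      S ⬝ᵥ (A⁻¹ *ᵥ S) + (2 * (z ⬝ᵥ (A⁻¹ *ᵥ S)) * η + (z ⬝ᵥ (A⁻¹ *ᵥ z)) * η ^ 2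
        - (z ⬝ᵥ (A⁻¹ *ᵥ S)) ^ 2) / (1 + z ⬝ᵥ (A⁻¹ *ᵥ z)) := by
  have hu := PosDef.dotProduct_inv_nonneg hA z
  have hv := PosDef.dotProduct_inv_comm hA S z
  set u := z ⬝ᵥ (A⁻¹ *ᵥ z) with hudef
  set v := z ⬝ᵥ (A⁻¹ *ᵥ S) with hvdef
  have hu1 : (1 + u) ≠ 0 := by positivity
  -- Sherman–Morrison: the updated system is solved by `A⁻¹ S + c A⁻¹ z`, and comparing the
  -- coefficients of `z` gives `c + v + c u = η`.
  set c := (η - v) / (1 + u) with hc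
  have hw : (A + vecMulVec z z) *ᵥ (A⁻¹ *ᵥ S + c • (A⁻¹ *ᵥ z)) = S + η • z := by
    rw [add_mulVec, vecMulVec_mulVec_self, mulVec_add, mulVec_smul, mulVec_mulVec, mulVec_mulVec,
      PosDef.mul_inv hA, one_mulVec, one_mulVec, dotProduct_add, dotProduct_smul, ← hudef,
      ← hvdef, smul_eq_mul, add_assoc, ← add_smul]
    congr 2
    rw [hc]
    field_simp
    ring
  have hB := posDef_add_vecMulVec hA z
  rw [← hw, mulVec_mulVec, PosDef.inv_mul hB, one_mulVec, hw, add_dotProduct, dotProduct_add,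
    dotProduct_add, smul_dotProduct, smul_dotProduct, dotProduct_smul, dotProduct_smul, hv,
    ← hudef, ← hvdef]
  simp only [smul_eq_mul]
  rw [hc]
  field_simp
  ring

theorem PosDef.abs_dotProduct_inv_le {A : Matrix n n ℝ} (hA : A.PosDef) (y z : n → ℝ) :
    |y ⬝ᵥ (A⁻¹ *ᵥ z)| ≤ √(y ⬝ᵥ (A⁻¹ *ᵥ y)) * √(z ⬝ᵥ (A⁻¹ *ᵥ z)) := by
  have h := LinearMap.BilinForm.apply_mul_apply_le_of_forall_zero_le (Matrix.toBilin' A⁻¹)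
    (fun x => by
      rw [Matrix.toBilin'_apply']
      exact PosDef.dotProduct_inv_nonneg hA x) y z
  simp only [Matrix.toBilin'_apply'] at h
  rw [PosDef.dotProduct_inv_comm hA z y, ← sq] at h
  rw [← Real.sqrt_mul (PosDef.dotProduct_inv_nonneg hA y), ← Real.sqrt_sq_eq_abs]
  exact Real.sqrt_le_sqrt h

theorem PosDef.dotProduct_inv_le {A : Matrix n n ℝ} (hA : A.PosDef) {β : ℝ} (hβ : 0 < β)
    (h : ∀ w, β * (w ⬝ᵥ w) ≤ w ⬝ᵥ (A *ᵥ w)) (z : n → ℝ) :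
    z ⬝ᵥ (A⁻¹ *ᵥ z) ≤ z ⬝ᵥ z / β := by
  have h1 := h (A⁻¹ *ᵥ z)
  rw [mulVec_mulVec, PosDef.mul_inv hA, one_mulVec, dotProduct_comm _ z] at h1
  set w := A⁻¹ *ᵥ z
  -- Expanding this square and inserting `β (w ⬝ᵥ w) ≤ z ⬝ᵥ w` leaves `β (z ⬝ᵥ w) ≤ z ⬝ᵥ z`.
  have h2 : 0 ≤ (z - β • w) ⬝ᵥ (z - β • w) := by
    simpa using dotProduct_star_self_nonneg (z - β • w)
  rw [sub_dotProduct, dotProduct_sub, dotProduct_sub, smul_dotProduct, smul_dotProduct,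
    dotProduct_smul, dotProduct_smul, dotProduct_comm w z] at h2
  simp only [smul_eq_mul] at h2
  rw [le_div_iff₀ hβ]
  nlinarith

theorem PosDef.det_le_pow {A : Matrix n n ℝ} (hA : A.PosDef) {M : ℝ}
    (h : ∀ w, w ⬝ᵥ (A *ᵥ w) ≤ M * (w ⬝ᵥ w)) : A.det ≤ M ^ Fintype.card n := by
  have hH := hA.isHermitian
  rw [hH.det_eq_prod_eigenvalues, ← Finset.card_univ, ← Finset.prod_const]
  refine Finset.prod_le_prod (fun i _ => (hA.eigenvalues_pos i).le) fun i _ => ?_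
  have h1 := h (hH.eigenvectorBasis i).ofLp
  have h2 : (hH.eigenvectorBasis i).ofLp ⬝ᵥ (hH.eigenvectorBasis i).ofLp = 1 := by
    have := hH.eigenvectorBasis.orthonormal.1 i
    have h3 := real_inner_self_eq_norm_sq (hH.eigenvectorBasis i)
    rw [this, EuclideanSpace.inner_eq_star_dotProduct] at h3
    simpa using h3
  have h4 := hH.mulVec_eigenvectorBasis i
  rw [h4, dotProduct_smul, h2] at h1
  simpa using h1

end LinearAlgebra

/-! ### The design matrix, the elliptical potential and the ridge estimate. -/

section Design

variable {d P : ℕ} {β Cx : ℝ} {x : Fin (P + 1) → EuclideanSpace ℝ (Fin d)}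

/-- An on-device frame has zero context, so its rank-one term vanishes and the update needs no case
distinction. -/
theorem matA_succ (hx : x (Fin.last P) = 0) (p : ℕ → Fin (P + 1)) (t : ℕ) :
    matA β x p (t + 1) =
      matA β x p t + vecMulVec (x (p (t + 1))).ofLp (x (p (t + 1))).ofLp := by
  by_cases h : p (t + 1) = Fin.last P
  · simp [matA, h, hx]
  · simp [matA, h]

theorem vecB_succ (hx : x (Fin.last P) = 0) (p : ℕ → Fin (P + 1)) (y : ℕ → ℝ) (t : ℕ) :
    vecB x p y (t + 1) = vecB x p y t + y (t + 1) • (x (p (t + 1))).ofLp := by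
  by_cases h : p (t + 1) = Fin.last P
  · simp [vecB, h, hx]
  · simp [vecB, h]

theorem dotProduct_ofLp_self (z : EuclideanSpace ℝ (Fin d)) : z.ofLp ⬝ᵥ z.ofLp = ‖z‖ ^ 2 := by
  rw [← real_inner_self_eq_norm_sq, EuclideanSpace.inner_eq_star_dotProduct, star_trivial]

theorem posDef_matA (hβ : 0 < β) (hx : x (Fin.last P) = 0) (p : ℕ → Fin (P + 1)) (t : ℕ) :
    (matA β x p t).PosDef := by
  induction t with
  | zero => exact PosDef.one.smul hβ
  | succ t ih =>
    rw [matA_succ hx]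
    exact posDef_add_vecMulVec ih _

theorem le_dotProduct_matA (hx : x (Fin.last P) = 0) (p : ℕ → Fin (P + 1)) (t : ℕ)
    (w : Fin d → ℝ) : β * (w ⬝ᵥ w) ≤ w ⬝ᵥ (matA β x p t *ᵥ w) := by
  induction t with
  | zero => simp [matA, smul_mulVec]
  | succ t ih =>
    rw [matA_succ hx, dotProduct_add_vecMulVec_mulVec]
    nlinarith [sq_nonneg ((x (p (t + 1))).ofLp ⬝ᵥ w)]

theorem dotProduct_matA_le (hx : x (Fin.last P) = 0) (hCx : ∀ q, ‖x q‖ ≤ Cx)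
    (p : ℕ → Fin (P + 1)) (t : ℕ) (w : Fin d → ℝ) :
    w ⬝ᵥ (matA β x p t *ᵥ w) ≤ (β + t * Cx ^ 2) * (w ⬝ᵥ w) := by
  induction t with
  | zero => simp [matA, smul_mulVec]
  | succ t ih =>
    rw [matA_succ hx, dotProduct_add_vecMulVec_mulVec]
    set z := x (p (t + 1))
    have h1 : (z.ofLp ⬝ᵥ w) ^ 2 ≤ Cx ^ 2 * (w ⬝ᵥ w) := by
      have h2 := abs_real_inner_le_norm (WithLp.toLp 2 w) z
      rw [EuclideanSpace.inner_eq_star_dotProduct, star_trivial] at h2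
      have h3 := dotProduct_ofLp_self (WithLp.toLp 2 w)
      simp only at h2 h3
      rw [h3, ← sq_abs, ← mul_pow]
      refine pow_le_pow_left₀ (abs_nonneg _) (h2.trans ?_) 2
      rw [mul_comm]
      exact mul_le_mul_of_nonneg_right (hCx _) (norm_nonneg _)
    push_cast
    nlinarith

/-- Every eigenvalue is at most `β + t Cx²`, and `β ≥ 1` lets the initial determinant `β ^ d` split
off. -/
theorem det_matA_le (hβ : 1 ≤ β) (hx : x (Fin.last P) = 0) (hCx : ∀ q, ‖x q‖ ≤ Cx)
    (p : ℕ → Fin (P + 1)) (t : ℕ) :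
    (matA β x p t).det ≤ β ^ d * (1 + t * Cx ^ 2) ^ d := by
  have h := PosDef.det_le_pow (posDef_matA (zero_lt_one.trans_le hβ) hx p t)
    (dotProduct_matA_le hx hCx p t)
  rw [Fintype.card_fin] at h
  refine h.trans ?_
  rw [← mul_pow]
  have h0 : (0 : ℝ) ≤ t * Cx ^ 2 := by positivity
  exact pow_le_pow_left₀ (by positivity) (by nlinarith) d

theorem det_matA_zero (p : ℕ → Fin (P + 1)) : (matA β x p 0).det = β ^ d := by
  simp [matA]

/-- The squared confidence width of the partition point `q` in frame `t + 1`. -/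
noncomputable def widthSq (β : ℝ) (x : Fin (P + 1) → EuclideanSpace ℝ (Fin d))
    (p : ℕ → Fin (P + 1)) (t : ℕ) (q : Fin (P + 1)) : ℝ :=
  (x q).ofLp ⬝ᵥ ((matA β x p t)⁻¹ *ᵥ (x q).ofLp)

theorem widthSq_nonneg (hβ : 0 < β) (hx : x (Fin.last P) = 0) (p : ℕ → Fin (P + 1)) (t : ℕ)
    (q : Fin (P + 1)) : 0 ≤ widthSq β x p t q :=
  PosDef.dotProduct_inv_nonneg (posDef_matA hβ hx p t) _

theorem widthSq_le (hβ : 1 ≤ β) (hx : x (Fin.last P) = 0) (hCx : ∀ q, ‖x q‖ ≤ Cx)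
    (p : ℕ → Fin (P + 1)) (t : ℕ) (q : Fin (P + 1)) : widthSq β x p t q ≤ Cx ^ 2 := by
  have hβ0 := zero_lt_one.trans_le hβ
  refine (PosDef.dotProduct_inv_le (posDef_matA hβ0 hx p t) hβ0
    (le_dotProduct_matA hx p t) _).trans ?_
  rw [dotProduct_ofLp_self]
  refine (div_le_self (sq_nonneg _) hβ).trans ?_
  exact pow_le_pow_left₀ (norm_nonneg _) (hCx q) 2

/-- The elliptical potential lemma, in terms of the determinant. -/
theorem sum_widthSq_le_log_det (hβ : 1 ≤ β) (hx : x (Fin.last P) = 0) (hCx : ∀ q, ‖x q‖ ≤ Cx)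
    (p : ℕ → Fin (P + 1)) (T : ℕ) :
    ∑ t ∈ Finset.range T, widthSq β x p t (p (t + 1)) ≤
      (1 + Cx ^ 2) * Real.log ((matA β x p T).det / β ^ d) := by
  have hβ0 := zero_lt_one.trans_le hβ
  induction T with
  | zero => simp [det_matA_zero, hβ0.ne']
  | succ T ih =>
    have hA := posDef_matA (β := β) hβ0 hx p T
    have hu := widthSq_nonneg (β := β) hβ0 hx p T (p (T + 1))
    have hu' := widthSq_le hβ hx hCx p T (p (T + 1))
    have hdet : (matA β x p (T + 1)).det / β ^ d =
        (matA β x p T).det / β ^ d * (1 + widthSq β x p T (p (T + 1))) := by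
      rw [matA_succ hx, det_add_vecMulVec hA, widthSq]
      ring
    have hdp := hA.det_pos
    rw [Finset.sum_range_succ, hdet, Real.log_mul (by positivity) (by positivity), mul_add]
    refine add_le_add ih ?_
    set u := widthSq β x p T (p (T + 1))
    have h1 := Real.one_sub_inv_le_log_of_pos (show 0 < 1 + u by positivity)
    -- The determinant grows by the factor `1 + u`. Since `u ≤ Cx²`, `u` is at most `(1 + Cx²) u /
    -- (1 + u)`, hence at most `(1 + Cx²) log (1 + u)`.
    have h2 : u ≤ (1 + Cx ^ 2) * (1 - (1 + u)⁻¹) := by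
      have h3 : 1 - (1 + u)⁻¹ = u / (1 + u) := by field_simp; ring
      rw [h3, mul_div_assoc', le_div_iff₀ (by positivity)]
      nlinarith
    exact h2.trans (mul_le_mul_of_nonneg_left h1 (by positivity))

theorem sum_widthSq_le (hβ : 1 ≤ β) (hx : x (Fin.last P) = 0) (hCx : ∀ q, ‖x q‖ ≤ Cx)
    (p : ℕ → Fin (P + 1)) (T : ℕ) :
    ∑ t ∈ Finset.range T, widthSq β x p t (p (t + 1)) ≤
      (1 + Cx ^ 2) * (d * Real.log (1 + T * Cx ^ 2)) := by
  have hβ0 := zero_lt_one.trans_le hβ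
  refine (sum_widthSq_le_log_det hβ hx hCx p T).trans ?_
  refine mul_le_mul_of_nonneg_left ?_ (by positivity)
  rw [← Real.log_pow]
  have hdp := (posDef_matA (β := β) hβ0 hx p T).det_pos
  refine Real.log_le_log (by positivity) ?_
  rw [div_le_iff₀ (by positivity), mul_comm]
  exact det_matA_le hβ hx hCx p T

/-- Separates signal from noise: `vecB` run on `η` alone is the noise sum `S_t`, and `β θ` is the
source of the ridge bias. -/
theorem vecB_observed (hx : x (Fin.last P) = 0) (p : ℕ → Fin (P + 1))
    (θ : EuclideanSpace ℝ (Fin d)) (η : ℕ → ℝ) (t : ℕ) :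
    vecB x p (fun t => inner ℝ θ (x (p t)) + η t) t + β • θ.ofLp =
      matA β x p t *ᵥ θ.ofLp + vecB x p η t := by
  induction t with
  | zero => simp [vecB, matA, smul_mulVec]
  | succ t ih =>
    rw [matA_succ hx, vecB_succ hx, vecB_succ hx, add_mulVec, vecMulVec_mulVec_self, add_smul,
      EuclideanSpace.inner_eq_star_dotProduct, star_trivial]
    rw [add_right_comm, ih]
    abel

/-- The error is the pairing of `x q` with `S_t - β θ` in the form of `A_t⁻¹`. Cauchy–Schwarz in
this form bounds both parts; as `A_t ≥ β I`, the norm of `θ` is at most `Cθ / √β`, which makes the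
bias term `√β Cθ`. -/
theorem abs_thetaHat_sub_le (hβ : 0 < β) (hx : x (Fin.last P) = 0) (p : ℕ → Fin (P + 1))
    (θ : EuclideanSpace ℝ (Fin d)) (η : ℕ → ℝ) (t : ℕ) (q : Fin (P + 1)) {r Cθ : ℝ}
    (hθ : ‖θ‖ ≤ Cθ)
    (hr : √(vecB x p η t ⬝ᵥ ((matA β x p t)⁻¹ *ᵥ vecB x p η t)) ≤ r) :
    |thetaHat β x p (fun t => inner ℝ θ (x (p t)) + η t) t ⬝ᵥ (x q).ofLp - inner ℝ θ (x q)| ≤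
      (√β * Cθ + r) * √(widthSq β x p t q) := by
  have hA := posDef_matA (β := β) hβ hx p t
  have hb := eq_sub_of_add_eq (vecB_observed (β := β) hx p θ η t)
  have hdot : thetaHat β x p (fun t => inner ℝ θ (x (p t)) + η t) t ⬝ᵥ (x q).ofLp
      - inner ℝ θ (x q) = (x q).ofLp ⬝ᵥ ((matA β x p t)⁻¹ *ᵥ vecB x p η t)
        - β * ((x q).ofLp ⬝ᵥ ((matA β x p t)⁻¹ *ᵥ θ.ofLp)) := by
    rw [thetaHat, hb, mulVec_sub, mulVec_add, mulVec_mulVec, PosDef.inv_mul hA, one_mulVec,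
      mulVec_smul, dotProduct_comm, EuclideanSpace.inner_eq_star_dotProduct, star_trivial,
      dotProduct_sub, dotProduct_add, dotProduct_smul, smul_eq_mul]
    ring
  have h1 := PosDef.abs_dotProduct_inv_le hA (x q).ofLp (vecB x p η t)
  have h2 := PosDef.abs_dotProduct_inv_le hA (x q).ofLp θ.ofLp
  have h3 : √(θ.ofLp ⬝ᵥ ((matA β x p t)⁻¹ *ᵥ θ.ofLp)) ≤ Cθ / √β := by
    refine (Real.sqrt_le_sqrt
      (PosDef.dotProduct_inv_le hA hβ (le_dotProduct_matA hx p t) _)).trans ?_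
    rw [dotProduct_ofLp_self, Real.sqrt_div (sq_nonneg _), Real.sqrt_sq (norm_nonneg _)]
    gcongr
  rw [hdot]
  change _ ≤ (√β * Cθ + r) * √((x q).ofLp ⬝ᵥ ((matA β x p t)⁻¹ *ᵥ (x q).ofLp))
  set w := √((x q).ofLp ⬝ᵥ ((matA β x p t)⁻¹ *ᵥ (x q).ofLp))
  have hw : 0 ≤ w := Real.sqrt_nonneg _
  refine (abs_sub _ _).trans ?_
  rw [abs_mul, abs_of_pos hβ]
  have h4 : β * |(x q).ofLp ⬝ᵥ ((matA β x p t)⁻¹ *ᵥ θ.ofLp)| ≤ β * (w * (Cθ / √β)) :=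
    mul_le_mul_of_nonneg_left (h2.trans (mul_le_mul_of_nonneg_left h3 hw)) hβ.le
  have h5 : β * (w * (Cθ / √β)) = √β * Cθ * w := by
    have hs : 0 < √β := Real.sqrt_pos.2 hβ
    have hss : √β ^ 2 = β := Real.sq_sqrt hβ.le
    field_simp
    rw [hss]
    ring
  have h6 := h1.trans (mul_le_mul_of_nonneg_left hr hw)
  rw [h5] at h4
  linarith

end Design

/-! ### Gaussian integrals by completing the square. -/

theorem lintegral_exp_neg_quadratic {b : ℝ} (hb : 0 < b) (c k : ℝ) :
    ∫⁻ g : ℝ, ENNReal.ofReal (Real.exp (-b * g ^ 2 + c * g + k)) =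
      ENNReal.ofReal (√(Real.pi / b) * Real.exp (c ^ 2 / (4 * b) + k)) := by
  have hrw : ∀ g : ℝ, Real.exp (-b * g ^ 2 + c * g + k) =
      Real.exp (-b * (g - c / (2 * b)) ^ 2) * Real.exp (c ^ 2 / (4 * b) + k) := by
    intro g
    rw [← Real.exp_add]
    congr 1
    field_simp
    ring
  have hint : Integrable fun g : ℝ => Real.exp (-b * (g - c / (2 * b)) ^ 2) :=
    (integrable_exp_neg_mul_sq hb).comp_sub_right (c / (2 * b))
  simp_rw [hrw]
  rw [← ofReal_integral_eq_lintegral_ofReal (hint.mul_const _)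
    (ae_of_all _ fun g => by positivity), integral_mul_const,
    integral_sub_right_eq_self (fun g : ℝ => Real.exp (-b * g ^ 2)), integral_gaussian]

/-- The Gaussian mixture over the exponential slopes `v / σ² + g √u / σ` of the sub-Gaussian
supermartingale increments has a closed form. -/
theorem lintegral_gaussian_mixture {σ u : ℝ} (hσ : 0 < σ) (hu : 0 ≤ u) (v η : ℝ) :
    ENNReal.ofReal ((√(2 * Real.pi))⁻¹) * ∫⁻ g : ℝ, ENNReal.ofReal (Real.exp (-g ^ 2 / 2)) *
        ENNReal.ofReal (Real.exp ((v / σ ^ 2 + g * (√u / σ)) * η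
          - (v / σ ^ 2 + g * (√u / σ)) ^ 2 * σ ^ 2 / 2)) =
      ENNReal.ofReal ((√(1 + u))⁻¹ *
        Real.exp ((2 * v * η + u * η ^ 2 - v ^ 2) / (1 + u) / (2 * σ ^ 2))) := by
  have h1u : 0 < 1 + u := by positivity
  have hrw : ∀ g : ℝ, ENNReal.ofReal (Real.exp (-g ^ 2 / 2)) *
        ENNReal.ofReal (Real.exp ((v / σ ^ 2 + g * (√u / σ)) * η
          - (v / σ ^ 2 + g * (√u / σ)) ^ 2 * σ ^ 2 / 2)) =
      ENNReal.ofReal (Real.exp (-((1 + u) / 2) * g ^ 2 + ((η - v) * √u / σ) * g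
        + (η * v / σ ^ 2 - v ^ 2 / (2 * σ ^ 2)))) := by
    intro g
    rw [← ENNReal.ofReal_mul (Real.exp_pos _).le, ← Real.exp_add]
    congr 2
    have hs : √u ^ 2 = u := Real.sq_sqrt hu
    field_simp
    ring_nf
    rw [hs]
  simp_rw [hrw]
  rw [lintegral_exp_neg_quadratic (by positivity), ← ENNReal.ofReal_mul (by positivity),
    ← mul_assoc]
  congr 2
  · rw [show Real.pi / ((1 + u) / 2) = 2 * Real.pi / (1 + u) by field_simp,
      Real.sqrt_div (by positivity)]
    field_simp
  · congr 1
    have hs : √u ^ 2 = u := Real.sq_sqrt hu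
    field_simp
    rw [hs]
    ring

/-! ### Exponential supermartingales with predictable slopes, and Ville's inequality. -/

section Probability

theorem exists_tendsto_finite_range {Ω : Type*} [MeasurableSpace Ω] {s : Ω → ℝ}
    (hs : Measurable s) : ∃ φ : ℕ → Ω → ℝ, (∀ n, Measurable (φ n)) ∧
      (∀ n, (Set.range (φ n)).Finite) ∧ ∀ ω, Tendsto (fun n => φ n ω) atTop (𝓝 (s ω)) :=
  ⟨fun n => hs.stronglyMeasurable.approx n, fun n => (hs.stronglyMeasurable.approx n).measurable,
    fun n => (hs.stronglyMeasurable.approx n).finite_range, hs.stronglyMeasurable.tendsto_approx⟩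

variable {Ω : Type*} {m mΩ : MeasurableSpace Ω} {ℙ : Measure Ω}

theorem setLIntegral_exp_le_of_condExp_le [IsProbabilityMeasure ℙ] (hm : m ≤ mΩ) {η : Ω → ℝ}
    {s K : ℝ} (hint : Integrable (fun ω => Real.exp (s * η ω)) ℙ)
    (hle : ℙ[fun ω => Real.exp (s * η ω) | m] ≤ᵐ[ℙ] fun _ => K) {B : Set Ω}
    (hB : MeasurableSet[m] B) :
    ∫⁻ ω in B, ENNReal.ofReal (Real.exp (s * η ω)) ∂ℙ ≤ ENNReal.ofReal K * ℙ B := by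
  rw [← ofReal_integral_eq_lintegral_ofReal hint.integrableOn
    (ae_of_all _ fun ω => (Real.exp_pos _).le), ← setIntegral_condExp hm hint hB]
  have h1 : ∫ ω in B, (ℙ[fun ω => Real.exp (s * η ω) | m]) ω ∂ℙ ≤ ∫ _ω in B, K ∂ℙ :=
    setIntegral_mono_ae integrable_condExp.integrableOn (integrable_const K).integrableOn hle
  refine (ENNReal.ofReal_le_ofReal h1).trans ?_
  rw [setIntegral_const, smul_eq_mul, mul_comm, ENNReal.ofReal_mul' measureReal_nonneg,
    ofReal_measureReal]

/-- The hypothesis compares two measures on `m`, the one with density `g` and `K • ℙ`; an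
`m`-measurable `f` can be integrated against both. -/
theorem lintegral_mul_le_of_setLIntegral_le [IsFiniteMeasure ℙ] (hm : m ≤ mΩ) {g : Ω → ℝ≥0∞}
    (hg : Measurable[mΩ] g) {K : ℝ≥0∞}
    (h : ∀ B, MeasurableSet[m] B → ∫⁻ ω in B, g ω ∂ℙ ≤ K * ℙ B) {f : Ω → ℝ≥0∞}
    (hf : Measurable[m] f) : ∫⁻ ω, f ω * g ω ∂ℙ ≤ K * ∫⁻ ω, f ω ∂ℙ := by
  have hle : (ℙ.withDensity g).trim hm ≤ (K • ℙ).trim hm := by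
    refine Measure.le_iff.2 fun B hB => ?_
    rw [trim_measurableSet_eq hm hB, trim_measurableSet_eq hm hB, withDensity_apply _ (hm B hB)]
    exact h B hB
  have h1 := lintegral_mono' hle (le_refl f)
  rw [lintegral_trim hm hf, lintegral_trim hm hf, lintegral_smul_measure,
    lintegral_withDensity_eq_lintegral_mul _ hg (hf.mono hm le_rfl)] at h1
  simpa [mul_comm] using h1

theorem lintegral_mul_exp_sub_le_of_const [IsProbabilityMeasure ℙ] (hm : m ≤ mΩ) {η : Ω → ℝ}
    (hη : Measurable[mΩ] η) {σ : ℝ}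
    (hint : ∀ s : ℝ, Integrable (fun ω => Real.exp (s * η ω)) ℙ)
    (hle : ∀ s : ℝ, ℙ[fun ω => Real.exp (s * η ω) | m] ≤ᵐ[ℙ]
      fun _ => Real.exp (s ^ 2 * σ ^ 2 / 2))
    {f : Ω → ℝ≥0∞} (hf : Measurable[m] f) (s : ℝ) :
    ∫⁻ ω, f ω * ENNReal.ofReal (Real.exp (s * η ω - s ^ 2 * σ ^ 2 / 2)) ∂ℙ ≤ ∫⁻ ω, f ω ∂ℙ := by
  have hgm : Measurable[mΩ] fun ω => ENNReal.ofReal (Real.exp (s * η ω)) := by fun_prop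
  have h1 := lintegral_mul_le_of_setLIntegral_le hm hgm
    (fun B hB => setLIntegral_exp_le_of_condExp_le hm (hint s) (hle s) hB) hf
  have hrw : ∀ ω, f ω * ENNReal.ofReal (Real.exp (s * η ω - s ^ 2 * σ ^ 2 / 2)) =
      ENNReal.ofReal (Real.exp (-(s ^ 2 * σ ^ 2 / 2))) *
        (f ω * ENNReal.ofReal (Real.exp (s * η ω))) := by
    intro ω
    rw [sub_eq_add_neg, Real.exp_add, ENNReal.ofReal_mul (Real.exp_pos _).le]
    ring
  simp_rw [hrw]
  rw [lintegral_const_mul' _ _ ENNReal.ofReal_ne_top]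
  refine (mul_le_mul_right h1 _).trans ?_
  rw [← mul_assoc, ← ENNReal.ofReal_mul (Real.exp_pos _).le, ← Real.exp_add]
  simp

/-- The slope of the exponential supermartingale increment may be random, as long as it is
known before the noise. -/
theorem lintegral_mul_exp_sub_le [IsProbabilityMeasure ℙ] (hm : m ≤ mΩ) {η : Ω → ℝ}
    (hη : Measurable[mΩ] η) {σ : ℝ}
    (hint : ∀ s : ℝ, Integrable (fun ω => Real.exp (s * η ω)) ℙ)
    (hle : ∀ s : ℝ, ℙ[fun ω => Real.exp (s * η ω) | m] ≤ᵐ[ℙ]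
      fun _ => Real.exp (s ^ 2 * σ ^ 2 / 2))
    {f : Ω → ℝ≥0∞} (hf : Measurable[m] f) {s : Ω → ℝ} (hs : Measurable[m] s) :
    ∫⁻ ω, f ω * ENNReal.ofReal (Real.exp (s ω * η ω - s ω ^ 2 * σ ^ 2 / 2)) ∂ℙ ≤
      ∫⁻ ω, f ω ∂ℙ := by
  have hfm : Measurable[mΩ] f := hf.mono hm le_rfl
  -- The conditional bound is available only for fixed slopes, with a null set that depends on the
  -- slope. A slope with finitely many values reduces to it by splitting `Ω` into level sets, which
  -- lie in `m`.
  have hsimple : ∀ φ : Ω → ℝ, Measurable[m] φ → (Set.range φ).Finite →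
      ∫⁻ ω, f ω * ENNReal.ofReal (Real.exp (φ ω * η ω - φ ω ^ 2 * σ ^ 2 / 2)) ∂ℙ ≤
        ∫⁻ ω, f ω ∂ℙ := by
    intro φ hφ hfin
    have hset : ∀ c, MeasurableSet[m] (φ ⁻¹' {c}) := fun c => hφ (measurableSet_singleton c)
    have hdecomp : ∀ g : Ω → ℝ≥0∞, ∀ ω,
        g ω = ∑ c ∈ hfin.toFinset, (φ ⁻¹' {c}).indicator g ω := by
      intro g ω
      rw [Finset.sum_eq_single (φ ω)]
      · simp
      · intro b _ hb
        exact Set.indicator_of_notMem (fun h => hb h.symm) _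
      · intro h
        exact absurd (hfin.mem_toFinset.2 ⟨ω, rfl⟩) h
    calc ∫⁻ ω, f ω * ENNReal.ofReal (Real.exp (φ ω * η ω - φ ω ^ 2 * σ ^ 2 / 2)) ∂ℙ
        = ∫⁻ ω, ∑ c ∈ hfin.toFinset, (φ ⁻¹' {c}).indicator f ω *
            ENNReal.ofReal (Real.exp (c * η ω - c ^ 2 * σ ^ 2 / 2)) ∂ℙ := by
          refine lintegral_congr fun ω => ?_
          rw [hdecomp (fun ω => f ω *
            ENNReal.ofReal (Real.exp (φ ω * η ω - φ ω ^ 2 * σ ^ 2 / 2))) ω]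
          refine Finset.sum_congr rfl fun c _ => ?_
          by_cases h : ω ∈ φ ⁻¹' {c}
          · rw [Set.indicator_of_mem h, Set.indicator_of_mem h]
            rw [show φ ω = c from h]
          · rw [Set.indicator_of_notMem h, Set.indicator_of_notMem h, zero_mul]
      _ = ∑ c ∈ hfin.toFinset, ∫⁻ ω, (φ ⁻¹' {c}).indicator f ω *
            ENNReal.ofReal (Real.exp (c * η ω - c ^ 2 * σ ^ 2 / 2)) ∂ℙ := by
          refine lintegral_finsetSum _ fun c _ => ?_
          exact (hfm.indicator (hm _ (hset c))).mul (by fun_prop)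
      _ ≤ ∑ c ∈ hfin.toFinset, ∫⁻ ω, (φ ⁻¹' {c}).indicator f ω ∂ℙ :=
          Finset.sum_le_sum fun c _ =>
            lintegral_mul_exp_sub_le_of_const hm hη hint hle (hf.indicator (hset c)) c
      _ = ∫⁻ ω, f ω ∂ℙ := by
          rw [← lintegral_finsetSum _ fun c _ => hfm.indicator (hm _ (hset c))]
          exact (lintegral_congr (hdecomp f)).symm
  obtain ⟨φ, hφ, hfin, hφs⟩ := @exists_tendsto_finite_range Ω m s hs
  have hlim : ∀ ω, Tendsto (fun n => f ω * ENNReal.ofReal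
      (Real.exp (φ n ω * η ω - φ n ω ^ 2 * σ ^ 2 / 2))) atTop
      (𝓝 (f ω * ENNReal.ofReal (Real.exp (s ω * η ω - s ω ^ 2 * σ ^ 2 / 2)))) := by
    intro ω
    have h1 := hφs ω
    have hc : Continuous fun r : ℝ => Real.exp (r * η ω - r ^ 2 * σ ^ 2 / 2) := by fun_prop
    exact ENNReal.Tendsto.const_mul (ENNReal.tendsto_ofReal ((hc.tendsto _).comp h1))
      (Or.inl (ENNReal.ofReal_pos.2 (Real.exp_pos _)).ne')
  -- Fatou's lemma passes to the limit of the finite-range slopes without any domination.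
  calc ∫⁻ ω, f ω * ENNReal.ofReal (Real.exp (s ω * η ω - s ω ^ 2 * σ ^ 2 / 2)) ∂ℙ
      = ∫⁻ ω, liminf (fun n => f ω * ENNReal.ofReal
          (Real.exp (φ n ω * η ω - φ n ω ^ 2 * σ ^ 2 / 2))) atTop ∂ℙ :=
        lintegral_congr fun ω => (hlim ω).liminf_eq.symm
    _ ≤ liminf (fun n => ∫⁻ ω, f ω * ENNReal.ofReal
          (Real.exp (φ n ω * η ω - φ n ω ^ 2 * σ ^ 2 / 2)) ∂ℙ) atTop := by
        refine lintegral_liminf_le fun n => ?_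
        have := (hφ n).mono hm le_rfl
        exact hfm.mul (by fun_prop)
    _ ≤ ∫⁻ ω, f ω ∂ℙ := by
        refine liminf_le_of_le (by isBoundedDefault) fun b hb => ?_
        obtain ⟨n, hn⟩ := hb.exists
        exact hn.trans (hsimple _ (hφ n) (hfin n))

/-- The factor is a standard Gaussian average over `g` of increments with slope `v / σ² + g √u / σ`.
By Tonelli the `ω`-integral is taken first; for each fixed `g` the slope is `m`-measurable. -/
theorem lintegral_mul_gaussian_mixture_le [IsProbabilityMeasure ℙ] (hm : m ≤ mΩ) {η : Ω → ℝ}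
    (hη : Measurable[mΩ] η) {σ : ℝ} (hσ : 0 < σ)
    (hint : ∀ s : ℝ, Integrable (fun ω => Real.exp (s * η ω)) ℙ)
    (hle : ∀ s : ℝ, ℙ[fun ω => Real.exp (s * η ω) | m] ≤ᵐ[ℙ]
      fun _ => Real.exp (s ^ 2 * σ ^ 2 / 2))
    {f : Ω → ℝ≥0∞} (hf : Measurable[m] f) {u v : Ω → ℝ} (hu : Measurable[m] u)
    (hv : Measurable[m] v) (hu0 : ∀ ω, 0 ≤ u ω) :
    ∫⁻ ω, f ω * ENNReal.ofReal ((√(1 + u ω))⁻¹ *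
      Real.exp ((2 * v ω * η ω + u ω * η ω ^ 2 - v ω ^ 2) / (1 + u ω) / (2 * σ ^ 2))) ∂ℙ ≤
      ∫⁻ ω, f ω ∂ℙ := by
  have hfm : Measurable[mΩ] f := hf.mono hm le_rfl
  have hum : Measurable[mΩ] u := hu.mono hm le_rfl
  have hvm : Measurable[mΩ] v := hv.mono hm le_rfl
  set κ := ENNReal.ofReal ((√(2 * Real.pi))⁻¹)
  set γ : ℝ → ℝ≥0∞ := fun g => ENNReal.ofReal (Real.exp (-g ^ 2 / 2))
  set slope : Ω → ℝ → ℝ := fun ω g => v ω / σ ^ 2 + g * (√(u ω) / σ)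
  set h : Ω → ℝ → ℝ≥0∞ := fun ω g =>
    ENNReal.ofReal (Real.exp (slope ω g * η ω - slope ω g ^ 2 * σ ^ 2 / 2))
  have hγ : Measurable γ := by fun_prop
  have hh : Measurable (Function.uncurry h) := by
    simp only [Function.uncurry_def, h, slope]
    fun_prop
  -- The Gaussian normalization is the closed form at `u = v = η = 0`.
  have hγ1 : κ * ∫⁻ g, γ g = 1 := by
    have := lintegral_gaussian_mixture hσ le_rfl 0 0
    simpa [κ, γ] using this
  calc ∫⁻ ω, f ω * ENNReal.ofReal ((√(1 + u ω))⁻¹ *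
        Real.exp ((2 * v ω * η ω + u ω * η ω ^ 2 - v ω ^ 2) / (1 + u ω) / (2 * σ ^ 2))) ∂ℙ
      = ∫⁻ ω, (∫⁻ g, κ * (γ g * (f ω * h ω g))) ∂ℙ := by
        refine lintegral_congr fun ω => ?_
        have hhω : Measurable (h ω) := hh.comp measurable_prodMk_left
        rw [← lintegral_gaussian_mixture hσ (hu0 ω) (v ω) (η ω),
          lintegral_const_mul _ (by fun_prop), mul_left_comm, ← lintegral_const_mul _ (by fun_prop)]
        congr 1
        refine lintegral_congr fun g => ?_
        exact mul_left_comm _ _ _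
    _ = ∫⁻ g, (∫⁻ ω, κ * (γ g * (f ω * h ω g)) ∂ℙ) := by
        refine lintegral_lintegral_swap (Measurable.aemeasurable ?_)
        simp only [Function.uncurry_def] at hh ⊢
        fun_prop
    _ ≤ ∫⁻ g, κ * (γ g * (∫⁻ ω, f ω ∂ℙ)) := by
        refine lintegral_mono fun g => ?_
        have hhg : Measurable fun ω => h ω g := hh.comp measurable_prodMk_right
        rw [lintegral_const_mul _ (by fun_prop), lintegral_const_mul _ (by fun_prop)]
        refine mul_le_mul_right (mul_le_mul_right ?_ _) _
        have hslope : Measurable[m] fun ω => slope ω g := by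
          simp only [slope]
          fun_prop
        exact lintegral_mul_exp_sub_le hm hη hint hle hf hslope
    _ = ∫⁻ ω, f ω ∂ℙ := by
        rw [lintegral_const_mul _ (by fun_prop), lintegral_mul_const _ hγ, ← mul_assoc, hγ1,
          one_mul]

/-- Ville's maximal inequality for nonnegative supermartingales, in integrated form. -/
theorem measure_exists_le_of_setLIntegral_le {ℱ : Filtration ℕ mΩ} {W : ℕ → Ω → ℝ≥0∞} {T : ℕ}
    (hW : ∀ t ≤ T, Measurable[ℱ t] (W t))
    (hstep : ∀ t < T, ∀ B, MeasurableSet[ℱ t] B →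
      ∫⁻ ω in B, W (t + 1) ω ∂ℙ ≤ ∫⁻ ω in B, W t ω ∂ℙ) (c : ℝ≥0∞) :
    c * ℙ {ω | ∃ t ≤ T, c ≤ W t ω} ≤ ∫⁻ ω, W 0 ω ∂ℙ := by
  have hmeas : ∀ t ≤ T, MeasurableSet[ℱ t] {ω | ∃ s ≤ t, c ≤ W s ω} := by
    intro t ht
    have : {ω | ∃ s ≤ t, c ≤ W s ω} = ⋃ s ∈ Set.Iic t, {ω | c ≤ W s ω} := by
      ext ω; simp
    rw [this]
    refine MeasurableSet.biUnion (Set.to_countable _) fun s hs => ?_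
    exact ℱ.mono hs _ (measurableSet_le (@measurable_const _ _ _ (ℱ s) _)
      (hW s (le_trans hs ht)))
  -- The left side bounds from below the mean of the process stopped on first reaching `c`: at least
  -- `c` where it has stopped, and `W t` elsewhere.
  have key : ∀ t ≤ T, c * ℙ {ω | ∃ s ≤ t, c ≤ W s ω} +
      ∫⁻ ω in {ω | ∃ s ≤ t, c ≤ W s ω}ᶜ, W t ω ∂ℙ ≤ ∫⁻ ω, W 0 ω ∂ℙ := by
    intro t
    induction t with
    | zero =>
      intro h0
      have hm0 := ℱ.le 0 _ (hmeas 0 h0)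
      refine le_of_le_of_eq ?_ (lintegral_add_compl (W 0) hm0)
      rw [← setLIntegral_const]
      refine add_le_add_left (setLIntegral_mono' hm0 fun ω hω => ?_) _
      obtain ⟨s, hs, h⟩ := hω
      rwa [Nat.le_zero.1 hs] at h
    | succ t ih =>
      intro ht
      have ih := ih (by omega)
      have hm1 := hmeas t (by omega)
      have hm2 := hmeas (t + 1) ht
      set E := {ω | ∃ s ≤ t, c ≤ W s ω}
      set E' := {ω | ∃ s ≤ t + 1, c ≤ W s ω}
      have hEE : E ⊆ E' := fun ω ⟨s, hs, h⟩ => ⟨s, by omega, h⟩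
      have hE1 := ℱ.le t _ hm1
      have hE2 := ℱ.le (t + 1) _ hm2
      have hsplit : ∫⁻ ω in Eᶜ, W (t + 1) ω ∂ℙ =
          ∫⁻ ω in E' \ E, W (t + 1) ω ∂ℙ + ∫⁻ ω in E'ᶜ, W (t + 1) ω ∂ℙ := by
        rw [← lintegral_union hE2.compl]
        · congr 2
          ext ω
          have := @hEE ω
          simp only [Set.mem_compl_iff, Set.mem_union, Set.mem_sdiff]
          tauto
        · exact Set.disjoint_left.2 fun ω h1 h2 => h2 h1.1
      have hlow : c * ℙ (E' \ E) ≤ ∫⁻ ω in E' \ E, W (t + 1) ω ∂ℙ := by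
        rw [← setLIntegral_const]
        refine setLIntegral_mono' (hE2.diff hE1) fun ω hω => ?_
        obtain ⟨⟨s, hs, h⟩, h2⟩ := hω
        rcases Nat.lt_or_ge t s with hlt | hge
        · rwa [show s = t + 1 by omega] at h
        · exact absurd ⟨s, hge, h⟩ h2
      have hadd : ℙ E' = ℙ E + ℙ (E' \ E) := by
        rw [← measure_union Set.disjoint_sdiff_right (hE2.diff hE1), Set.union_sdiff_cancel hEE]
      calc c * ℙ E' + ∫⁻ ω in E'ᶜ, W (t + 1) ω ∂ℙ
          = c * ℙ E + (c * ℙ (E' \ E) + ∫⁻ ω in E'ᶜ, W (t + 1) ω ∂ℙ) := by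
            rw [hadd, mul_add, add_assoc]
        _ ≤ c * ℙ E + ∫⁻ ω in Eᶜ, W (t + 1) ω ∂ℙ := by rw [hsplit]; gcongr
        _ ≤ c * ℙ E + ∫⁻ ω in Eᶜ, W t ω ∂ℙ := by
            gcongr 1
            exact hstep t (by omega) _ hm1.compl
        _ ≤ _ := ih
  exact le_self_add.trans (key T le_rfl)

end Probability

/-! ### The self-normalized concentration inequality. -/

section Confidence

theorem matA_congr {d P : ℕ} (β : ℝ) (x : Fin (P + 1) → EuclideanSpace ℝ (Fin d))
    {p p' : ℕ → Fin (P + 1)} {t : ℕ} (h : ∀ i < t, p (i + 1) = p' (i + 1)) :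
    matA β x p t = matA β x p' t := by
  induction t with
  | zero => rfl
  | succ t ih =>
    simp only [matA]
    rw [ih fun i hi => h i (by omega), h t (by omega)]

/-- `A_t` depends only on `t` decisions with finitely many values each, so an arbitrary `g`, such as
an entry of the inverse, is allowed. -/
theorem measurable_comp_matA {Ω : Type*} [MeasurableSpace Ω] {d P : ℕ} (β : ℝ)
    (x : Fin (P + 1) → EuclideanSpace ℝ (Fin d)) {p : ℕ → Ω → Fin (P + 1)} {t : ℕ}
    (hp : ∀ i < t, Measurable (p (i + 1))) (g : Matrix (Fin d) (Fin d) ℝ → ℝ) :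
    Measurable fun ω => g (matA β x (fun i => p i ω) t) := by
  let ext : (Fin t → Fin (P + 1)) → ℕ → Fin (P + 1) := fun q i =>
    if h : i - 1 < t then q ⟨i - 1, h⟩ else 0
  have h1 : (fun ω => g (matA β x (fun i => p i ω) t)) =
      (fun q => g (matA β x (ext q) t)) ∘ fun ω (i : Fin t) => p (i + 1) ω := by
    funext ω
    simp only [Function.comp_apply]
    rw [matA_congr β x (p' := ext fun i : Fin t => p (i + 1) ω)]
    intro i hi
    simp [ext, hi]
  rw [h1]
  exact (measurable_of_finite _).comp (measurable_pi_lambda _ fun i => hp i i.2)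

theorem measurable_vecB {Ω : Type*} [MeasurableSpace Ω] {d P : ℕ}
    (x : Fin (P + 1) → EuclideanSpace ℝ (Fin d)) {p : ℕ → Ω → Fin (P + 1)} {η : ℕ → Ω → ℝ}
    {t : ℕ} (hp : ∀ i < t, Measurable (p (i + 1))) (hη : ∀ i < t, Measurable (η (i + 1)))
    (hx : x (Fin.last P) = 0) (j : Fin d) :
    Measurable fun ω => vecB x (fun i => p i ω) (fun i => η i ω) t j := by
  induction t with
  | zero => simp [vecB]
  | succ t ih =>
    simp only [vecB_succ hx, Pi.add_apply, Pi.smul_apply, smul_eq_mul]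
    refine (ih (fun i hi => hp i (by omega)) (fun i hi => hη i (by omega))).add
      ((hη t (by omega)).mul ?_)
    exact (measurable_of_finite fun q => (x q).ofLp j).comp (hp t (by omega))

theorem measurable_dotProduct_mulVec {Ω n : Type*} [MeasurableSpace Ω] [Fintype n]
    {y z : Ω → n → ℝ} {M : Ω → Matrix n n ℝ} (hy : ∀ i, Measurable fun ω => y ω i)
    (hz : ∀ i, Measurable fun ω => z ω i) (hM : ∀ i j, Measurable fun ω => M ω i j) :
    Measurable fun ω => y ω ⬝ᵥ (M ω *ᵥ z ω) := by
  simp only [dotProduct, mulVec]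
  fun_prop

/-- The self-normalized exponential process `(β^d / det A_t)^(1/2) exp (‖S_t‖² / (2 σ²))`, where
`S_t` is the weighted sum of the noise and the norm is that of `A_t⁻¹`. -/
noncomputable def mixtureProcess {d P : ℕ} (β σ : ℝ) (x : Fin (P + 1) → EuclideanSpace ℝ (Fin d))
    (p : ℕ → Fin (P + 1)) (η : ℕ → ℝ) (t : ℕ) : ℝ≥0∞ :=
  ENNReal.ofReal (√(β ^ d / (matA β x p t).det) *
    Real.exp (vecB x p η t ⬝ᵥ ((matA β x p t)⁻¹ *ᵥ vecB x p η t) / (2 * σ ^ 2)))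

variable {d P : ℕ} {β Cx : ℝ} {x : Fin (P + 1) → EuclideanSpace ℝ (Fin d)}

/-- The determinant lemma and Sherman–Morrison produce exactly the multiplier computed in
`lintegral_gaussian_mixture`, with `u` the squared width and `v` the pairing of the new context with
`S_t`. -/
theorem mixtureProcess_succ (hβ : 0 < β) (hx : x (Fin.last P) = 0) (σ : ℝ)
    (p : ℕ → Fin (P + 1)) (η : ℕ → ℝ) (t : ℕ) :
    mixtureProcess β σ x p η (t + 1) = mixtureProcess β σ x p η t *
      ENNReal.ofReal ((√(1 + widthSq β x p t (p (t + 1))))⁻¹ *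
        Real.exp ((2 * ((x (p (t + 1))).ofLp ⬝ᵥ ((matA β x p t)⁻¹ *ᵥ vecB x p η t)) * η (t + 1)
          + widthSq β x p t (p (t + 1)) * η (t + 1) ^ 2
          - ((x (p (t + 1))).ofLp ⬝ᵥ ((matA β x p t)⁻¹ *ᵥ vecB x p η t)) ^ 2)
          / (1 + widthSq β x p t (p (t + 1))) / (2 * σ ^ 2))) := by
  have hA := posDef_matA (β := β) hβ hx p t
  have hu := widthSq_nonneg (β := β) hβ hx p t (p (t + 1))
  have hdp := hA.det_pos
  rw [mixtureProcess, mixtureProcess, ← ENNReal.ofReal_mul (by positivity), matA_succ hx,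
    vecB_succ hx, det_add_vecMulVec hA, dotProduct_inv_add_vecMulVec hA, add_div, Real.exp_add]
  change ENNReal.ofReal (√(_ / (_ * (1 + widthSq β x p t (p (t + 1))))) * (_ *
    Real.exp (_ / (1 + widthSq β x p t (p (t + 1))) / _))) = _
  rw [← div_div, Real.sqrt_div (by positivity), widthSq]
  congr 1
  ring

variable {Ω : Type*} {mΩ : MeasurableSpace Ω} {ℙ : Measure Ω} {ℱ : Filtration ℕ mΩ} {σ : ℝ}
  {T : ℕ} {η : ℕ → Ω → ℝ} {p : ℕ → Ω → Fin (P + 1)}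

theorem measurable_mixtureProcess (hx : x (Fin.last P) = 0)
    (hη : ∀ t < T, Measurable[ℱ (t + 1)] (η (t + 1)))
    (hp : ∀ t < T, Measurable[ℱ t] (p (t + 1))) {t : ℕ} (ht : t ≤ T) :
    Measurable[ℱ t] fun ω => mixtureProcess β σ x (fun i => p i ω) (fun i => η i ω) t := by
  have hp' : ∀ i < t, Measurable[ℱ t] (p (i + 1)) := fun i hi =>
    (hp i (by omega)).mono (ℱ.mono hi.le) le_rfl
  have hη' : ∀ i < t, Measurable[ℱ t] (η (i + 1)) := fun i hi =>
    (hη i (by omega)).mono (ℱ.mono hi) le_rfl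
  have h1 := @measurable_comp_matA Ω (ℱ t) d P β x p t hp' fun A => √(β ^ d / A.det)
  have h2 := @measurable_dotProduct_mulVec Ω (Fin d) (ℱ t) _ _ _ _
    (@measurable_vecB Ω (ℱ t) d P x p η t hp' hη' hx)
    (@measurable_vecB Ω (ℱ t) d P x p η t hp' hη' hx)
    (fun i j => @measurable_comp_matA Ω (ℱ t) d P β x p t hp' fun A => A⁻¹ i j)
  exact (h1.mul (Real.measurable_exp.comp (h2.div_const _))).ennreal_ofReal

/-- The supermartingale property: `u` and `v` are known before the noise, and the current value
restricted to `B` serves as the weight `f`. -/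
theorem setLIntegral_mixtureProcess_succ_le [IsProbabilityMeasure ℙ] (hβ : 0 < β) (hσ : 0 < σ)
    (hx : x (Fin.last P) = 0) (hη : IsSubGaussianNoise ℙ ℱ σ T η)
    (hp : ∀ t < T, Measurable[ℱ t] (p (t + 1))) {t : ℕ} (ht : t < T) {B : Set Ω}
    (hB : MeasurableSet[ℱ t] B) :
    ∫⁻ ω in B, mixtureProcess β σ x (fun i => p i ω) (fun i => η i ω) (t + 1) ∂ℙ ≤
      ∫⁻ ω in B, mixtureProcess β σ x (fun i => p i ω) (fun i => η i ω) t ∂ℙ := by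
  have hp' : ∀ i < t, Measurable[ℱ t] (p (i + 1)) := fun i hi =>
    (hp i (by omega)).mono (ℱ.mono hi.le) le_rfl
  have hη' : ∀ i < t, Measurable[ℱ t] (η (i + 1)) := fun i hi =>
    (hη.adapted i (by omega)).mono (ℱ.mono hi) le_rfl
  have hz : ∀ j, Measurable[ℱ t] fun ω => (x (p (t + 1) ω)).ofLp j := fun j =>
    (measurable_of_finite fun q => (x q).ofLp j).comp (hp t ht)
  have hAinv := fun i j => @measurable_comp_matA Ω (ℱ t) d P β x p t hp' fun A => A⁻¹ i j
  have hu := @measurable_dotProduct_mulVec Ω (Fin d) (ℱ t) _ _ _ _ hz hz hAinv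
  have hv := @measurable_dotProduct_mulVec Ω (Fin d) (ℱ t) _ _ _ _ hz
    (@measurable_vecB Ω (ℱ t) d P x p η t hp' hη' hx) hAinv
  have hW := measurable_mixtureProcess (β := β) (σ := σ) hx hη.adapted hp ht.le
  have key := lintegral_mul_gaussian_mixture_le (ℱ.le t)
    ((hη.adapted t ht).mono (ℱ.le _) le_rfl) hσ (hη.integrable_exp t ht)
    (hη.condExp_exp_le t ht) (hW.indicator hB) hu hv
    (fun ω => widthSq_nonneg hβ hx (fun i => p i ω) t (p (t + 1) ω))
  rw [← lintegral_indicator (ℱ.le t _ hB), ← lintegral_indicator (ℱ.le t _ hB)]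
  refine le_trans (le_of_eq (lintegral_congr fun ω => ?_)) key
  by_cases h : ω ∈ B
  · rw [Set.indicator_of_mem h, Set.indicator_of_mem h, mixtureProcess_succ hβ hx]
    rfl
  · rw [Set.indicator_of_notMem h, Set.indicator_of_notMem h, zero_mul]

theorem mixtureProcess_zero (hβ : 0 < β) (p : ℕ → Fin (P + 1)) (η : ℕ → ℝ) :
    mixtureProcess β σ x p η 0 = 1 := by
  rw [mixtureProcess, det_matA_zero]
  simp [vecB, hβ.ne']

theorem measure_exists_inv_le_mixtureProcess [IsProbabilityMeasure ℙ] (hβ : 0 < β) (hσ : 0 < σ)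
    (hx : x (Fin.last P) = 0) (hη : IsSubGaussianNoise ℙ ℱ σ T η)
    (hp : ∀ t < T, Measurable[ℱ t] (p (t + 1))) {δ : ℝ} (hδ : 0 < δ) :
    ℙ {ω | ∃ t ≤ T, ENNReal.ofReal δ⁻¹ ≤
      mixtureProcess β σ x (fun i => p i ω) (fun i => η i ω) t} ≤ ENNReal.ofReal δ := by
  have h := measure_exists_le_of_setLIntegral_le (ℙ := ℙ)
    (fun t ht => measurable_mixtureProcess (β := β) (σ := σ) hx hη.adapted hp ht)
    (fun t ht B hB => setLIntegral_mixtureProcess_succ_le hβ hσ hx hη hp ht hB)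
    (ENNReal.ofReal δ⁻¹)
  simp only [mixtureProcess_zero hβ, lintegral_const, measure_univ, mul_one] at h
  rw [ENNReal.ofReal_inv_of_pos hδ, ← ENNReal.div_eq_inv_mul] at h
  rw [ENNReal.ofReal_inv_of_pos hδ]
  have h0 : ENNReal.ofReal δ ≠ 0 := (ENNReal.ofReal_pos.2 hδ).ne'
  simpa using (ENNReal.div_le_iff h0 ENNReal.ofReal_ne_top).1 h

/-- As long as the self-normalized exponential process stays below `1 / δ`, the noise sum is small
in the norm of `A_t⁻¹`. -/
theorem dotProduct_inv_le_of_mixtureProcess_lt (hβ : 1 ≤ β) (hσ : 0 < σ)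
    (hx : x (Fin.last P) = 0) (hCx : ∀ q, ‖x q‖ ≤ Cx) {δ : ℝ} (hδ : 0 < δ) (hδ1 : δ < 1)
    (p : ℕ → Fin (P + 1)) (η : ℕ → ℝ) {t : ℕ} (ht : t ≤ T)
    (h : mixtureProcess β σ x p η t < ENNReal.ofReal δ⁻¹) :
    vecB x p η t ⬝ᵥ ((matA β x p t)⁻¹ *ᵥ vecB x p η t) ≤
      σ ^ 2 * (max (d : ℝ) 2 * Real.log ((1 + T * Cx ^ 2) / δ)) := by
  have hβ0 := zero_lt_one.trans_le hβ
  have hdp := (posDef_matA (β := β) hβ0 hx p t).det_pos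
  have hdet := det_matA_le hβ hx hCx p t
  have hδi : 0 < δ⁻¹ := inv_pos.2 hδ
  rw [mixtureProcess, ENNReal.ofReal_lt_ofReal_iff hδi] at h
  set Q := vecB x p η t ⬝ᵥ ((matA β x p t)⁻¹ *ᵥ vecB x p η t)
  have hlog := Real.log_lt_log (by positivity) h
  rw [Real.log_mul (by positivity) (by positivity), Real.log_exp, Real.log_sqrt (by positivity),
    Real.log_inv] at hlog
  have hbase : (1 : ℝ) + t * Cx ^ 2 ≤ 1 + T * Cx ^ 2 := by
    have : (t : ℝ) ≤ T := by exact_mod_cast ht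
    nlinarith [sq_nonneg Cx]
  have h1 : -(d * Real.log (1 + T * Cx ^ 2)) ≤ Real.log (β ^ d / (matA β x p t).det) := by
    rw [← Real.log_pow, ← Real.log_inv]
    refine Real.log_le_log (by positivity) ?_
    rw [inv_le_comm₀ (by positivity) (by positivity), inv_div, div_le_iff₀ (by positivity),
      mul_comm]
    refine hdet.trans ?_
    gcongr
  have h2 : 0 ≤ Real.log (1 + T * Cx ^ 2) := Real.log_nonneg (by
    have : (0 : ℝ) ≤ T * Cx ^ 2 := by positivity
    linarith)
  have h3 : Real.log δ ≤ 0 := Real.log_nonpos hδ.le hδ1.le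
  rw [Real.log_div (by positivity) hδ.ne']
  have h4 : Q / σ ^ 2 < d * Real.log (1 + T * Cx ^ 2) - 2 * Real.log δ := by
    rw [show Q / (2 * σ ^ 2) = Q / σ ^ 2 / 2 by field_simp] at hlog
    linarith
  have h5 : Q < (d * Real.log (1 + T * Cx ^ 2) - 2 * Real.log δ) * σ ^ 2 :=
    (div_lt_iff₀ (by positivity)).1 h4
  refine h5.le.trans ?_
  rw [mul_comm]
  refine mul_le_mul_of_nonneg_left ?_ (sq_nonneg σ)
  -- The determinant contributes `d log (1 + T Cx²)` and Ville's inequality `2 log (1/δ)`; `max d 2`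
  -- dominates both coefficients.
  nlinarith [le_max_left (d : ℝ) 2, le_max_right (d : ℝ) 2]

theorem ae_eq_zero_of_isSubGaussianNoise_zero [IsProbabilityMeasure ℙ]
    (hη : IsSubGaussianNoise ℙ ℱ 0 T η) {t : ℕ} (ht : t < T) : η (t + 1) =ᵐ[ℙ] 0 := by
  refine ProbabilityTheory.HasSubgaussianMGF.ae_eq_zero_of_hasSubgaussianMGF_zero
    ⟨hη.integrable_exp t ht, fun s => ?_⟩
  have h := integral_mono_ae integrable_condExp (integrable_const _) (hη.condExp_exp_le t ht s)
  rw [integral_condExp (ℱ.le t)] at h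
  simpa [ProbabilityTheory.mgf] using h

theorem vecB_eq_zero (hx : x (Fin.last P) = 0) (p : ℕ → Fin (P + 1)) {η : ℕ → ℝ} {t : ℕ}
    (h : ∀ i < t, η (i + 1) = 0) : vecB x p η t = 0 := by
  induction t with
  | zero => rfl
  | succ t ih =>
    rw [vecB_succ hx, ih fun i hi => h i (by omega), h t (by omega), zero_smul, add_zero]

/-- The self-normalized concentration inequality for the noise. -/
theorem ofReal_le_measure_confidence [IsProbabilityMeasure ℙ] (hβ : 1 ≤ β) (hσ : 0 ≤ σ)
    (hx : x (Fin.last P) = 0) (hCx : ∀ q, ‖x q‖ ≤ Cx) (hη : IsSubGaussianNoise ℙ ℱ σ T η)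
    (hp : ∀ t < T, Measurable[ℱ t] (p (t + 1))) {δ : ℝ} (hδ : 0 < δ) (hδ1 : δ < 1) :
    ENNReal.ofReal (1 - δ) ≤ ℙ {ω | ∀ t ≤ T,
      vecB x (fun i => p i ω) (fun i => η i ω) t ⬝ᵥ ((matA β x (fun i => p i ω) t)⁻¹ *ᵥ
        vecB x (fun i => p i ω) (fun i => η i ω) t) ≤
        σ ^ 2 * (max (d : ℝ) 2 * Real.log ((1 + T * Cx ^ 2) / δ))} := by
  have hβ0 := zero_lt_one.trans_le hβ
  -- The mixture divides by `σ²`. For `σ = 0` the noise vanishes almost surely, and so does `S_t`.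
  rcases hσ.eq_or_lt with rfl | hσ
  · have hae : ∀ᵐ ω ∂ℙ, ∀ i < T, η (i + 1) ω = 0 := by
      refine ae_all_iff.2 fun i => ?_
      by_cases hi : i < T
      · filter_upwards [ae_eq_zero_of_isSubGaussianNoise_zero hη hi] with ω hω _ using hω
      · exact ae_of_all _ fun ω h => absurd h hi
    refine le_trans (ENNReal.ofReal_le_one.2 (by linarith)) (le_of_eq ?_)
    refine ((measure_congr (eventuallyEq_univ.2 ?_)).trans measure_univ).symm
    filter_upwards [hae] with ω hω t ht
    rw [vecB_eq_zero hx _ fun i hi => hω i (by omega)]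
    simp
  · set E := {ω | ∃ t ≤ T, ENNReal.ofReal δ⁻¹ ≤
      mixtureProcess β σ x (fun i => p i ω) (fun i => η i ω) t}
    have hE : ℙ E ≤ ENNReal.ofReal δ :=
      measure_exists_inv_le_mixtureProcess hβ0 hσ hx hη hp hδ
    -- Subadditivity suffices here, so `E` need not be shown measurable.
    have h1 : 1 - ℙ E ≤ ℙ Eᶜ := by
      rw [tsub_le_iff_left, ← measure_univ (μ := ℙ), ← Set.union_compl_self E]
      exact measure_union_le _ _
    rw [ENNReal.ofReal_sub _ hδ.le, ENNReal.ofReal_one]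
    refine (tsub_le_tsub_left hE 1).trans (h1.trans (measure_mono fun ω hω t ht => ?_))
    refine dotProduct_inv_le_of_mixtureProcess_lt hβ hσ hx hCx hδ hδ1 _ _ ht ?_
    by_contra hcon
    exact hω ⟨t, ht, not_lt.1 hcon⟩

end Confidence

/-! ### Regret on the confidence event. -/

section Regret

/-- Rounding moves `n T^μ` by less than `1`, so a forced frame up to `T` has `n T^μ ≤ T + 1 ≤ 2T`.
-/
theorem card_forcedFrames_le {ρ : ℝ → ℕ} (hρ : IsRounding ρ) {μ : ℝ} {T : ℕ} (hT : 1 ≤ T)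
    [DecidablePred fun t => t + 1 ∈ forcedFrames ρ μ T] :
    (((Finset.range T).filter fun t => t + 1 ∈ forcedFrames ρ μ T).card : ℝ) ≤
      2 * (T : ℝ) ^ (1 - μ) := by
  have hT1 : (1 : ℝ) ≤ T := by exact_mod_cast hT
  have hT0 : (0 : ℝ) < T := by linarith
  have hpow : 0 < (T : ℝ) ^ μ := Real.rpow_pos_of_pos hT0 μ
  set K := ⌊((T : ℝ) + 1) / (T : ℝ) ^ μ⌋₊ with hK
  have hsub : ((Finset.range T).filter fun t => t + 1 ∈ forcedFrames ρ μ T) ⊆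
      (Finset.Icc 1 K).image fun n : ℕ => ρ ((n : ℝ) * (T : ℝ) ^ μ) - 1 := by
    intro t ht
    obtain ⟨-, ⟨htT, n, hn, htn⟩⟩ := Finset.mem_filter.1 ht
    refine Finset.mem_image.2 ⟨n, Finset.mem_Icc.2 ⟨hn, ?_⟩, by omega⟩
    refine Nat.le_floor ?_
    rw [le_div_iff₀ hpow]
    have h := (abs_lt.1 (hρ _ (by positivity : (0 : ℝ) ≤ (n : ℝ) * (T : ℝ) ^ μ))).1
    rw [← htn] at h
    have : ((t + 1 : ℕ) : ℝ) ≤ T := by exact_mod_cast htT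
    linarith
  have hcard := (Finset.card_le_card hsub).trans Finset.card_image_le
  rw [Nat.card_Icc, Nat.add_sub_cancel] at hcard
  calc (((Finset.range T).filter fun t => t + 1 ∈ forcedFrames ρ μ T).card : ℝ)
      ≤ K := by exact_mod_cast hcard
    _ ≤ ((T : ℝ) + 1) / (T : ℝ) ^ μ := Nat.floor_le (by positivity)
    _ ≤ 2 * (T / (T : ℝ) ^ μ) := by rw [mul_div_assoc']; gcongr; linarith
    _ = 2 * (T : ℝ) ^ (1 - μ) := by rw [Real.rpow_sub hT0, Real.rpow_one]

variable {d P : ℕ} {β Cx : ℝ} {df : Fin (P + 1) → ℝ} {θ : EuclideanSpace ℝ (Fin d)}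
  {x : Fin (P + 1) → EuclideanSpace ℝ (Fin d)}

theorem exists_expectedDelay_eq_oracleDelay : ∃ q, expectedDelay df θ x q = oracleDelay df θ x := by
  obtain ⟨q, -, hq⟩ := Finset.exists_mem_eq_inf' Finset.univ_nonempty (expectedDelay df θ x)
  exact ⟨q, hq.symm⟩

theorem expectedDelay_sub_oracleDelay_le {Δ : ℝ}
    (hΔ : ∀ q, |expectedDelay df θ x q - expectedDelay df θ x (Fin.last P)| ≤ Δ)
    (q : Fin (P + 1)) : expectedDelay df θ x q - oracleDelay df θ x ≤ 2 * Δ := by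
  obtain ⟨r, hr⟩ := exists_expectedDelay_eq_oracleDelay (df := df) (θ := θ) (x := x)
  have h1 := (abs_le.1 (hΔ q)).2
  have h2 := (abs_le.1 (hΔ r)).1
  linarith

/-- Optimism survives the frame weight because `√(1 - L) ≥ 1 - Lkey`: the scaled width still covers
the error `κ` at the best point, whose score is thus at most the oracle delay. At the chosen point
the width and the error cost at most `α` widths each. -/
theorem expectedDelay_sub_oracleDelay_le_width {p : ℕ → Fin (P + 1)} {y L : ℕ → ℝ} {t : ℕ}
    {κ Lkey : ℝ} (hκ : 0 ≤ κ) (hLkey : Lkey < 1) (hL0 : 0 < L (t + 1)) (hL1 : L (t + 1) ≤ Lkey)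
    (hest : ∀ q, |thetaHat β x p y t ⬝ᵥ (x q).ofLp - inner ℝ θ (x q)| ≤
      κ * √(widthSq β x p t q))
    (hmin : ∀ q, score (κ / (1 - Lkey)) β df x L p y t (p (t + 1)) ≤
      score (κ / (1 - Lkey)) β df x L p y t q) :
    expectedDelay df θ x (p (t + 1)) - oracleDelay df θ x ≤
      2 * (κ / (1 - Lkey)) * √(widthSq β x p t (p (t + 1))) := by
  have hk : 0 < 1 - Lkey := by linarith
  have hκα : κ ≤ κ / (1 - Lkey) := le_div_self hκ hk (by linarith)
  have hwt : 0 ≤ 1 - L (t + 1) := by linarith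
  have hs1 : √(1 - L (t + 1)) ≤ 1 := Real.sqrt_le_one.2 (by linarith)
  have hs2 : 1 - Lkey ≤ √(1 - L (t + 1)) := by
    refine Real.le_sqrt_of_sq_le ?_
    nlinarith
  have hs3 : κ ≤ κ / (1 - Lkey) * √(1 - L (t + 1)) := by
    rw [div_mul_eq_mul_div, le_div_iff₀ hk]
    exact mul_le_mul_of_nonneg_left hs2 hκ
  have hscore : ∀ q, score (κ / (1 - Lkey)) β df x L p y t q =
      df q + thetaHat β x p y t ⬝ᵥ (x q).ofLp -
        κ / (1 - Lkey) * √(1 - L (t + 1)) * √(widthSq β x p t q) := by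
    intro q
    rw [score, widthSq, Real.sqrt_mul hwt, mul_assoc]
  obtain ⟨r, hr⟩ := exists_expectedDelay_eq_oracleDelay (df := df) (θ := θ) (x := x)
  have h1 := hmin r
  rw [hscore, hscore] at h1
  have h2 := (abs_le.1 (hest r)).2
  have h3 := (abs_le.1 (hest (p (t + 1)))).1
  have h4 := mul_le_mul_of_nonneg_right hs3 (Real.sqrt_nonneg (widthSq β x p t r))
  have hα0 : 0 ≤ κ / (1 - Lkey) := by positivity
  have h5 : κ / (1 - Lkey) * √(1 - L (t + 1)) * √(widthSq β x p t (p (t + 1))) ≤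
      κ / (1 - Lkey) * √(widthSq β x p t (p (t + 1))) :=
    mul_le_mul_of_nonneg_right (mul_le_of_le_one_right hα0 hs1) (Real.sqrt_nonneg _)
  have h6 := mul_le_mul_of_nonneg_right hκα (Real.sqrt_nonneg (widthSq β x p t (p (t + 1))))
  rw [← hr, expectedDelay, expectedDelay]
  linarith

theorem regret_eq_sum_range (p : ℕ → Fin (P + 1)) (T : ℕ) :
    regret df θ x p T =
      ∑ t ∈ Finset.range T, (expectedDelay df θ x (p (t + 1)) - oracleDelay df θ x) := by
  rw [regret, Finset.range_eq_Ico,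
    Finset.sum_Ico_add' (fun t => expectedDelay df θ x (p t) - oracleDelay df θ x) 0 T 1]
  rfl

theorem sum_sqrt_widthSq_le (hβ : 1 ≤ β) (hx : x (Fin.last P) = 0) (hCx : ∀ q, ‖x q‖ ≤ Cx)
    (p : ℕ → Fin (P + 1)) (T : ℕ) :
    ∑ t ∈ Finset.range T, √(widthSq β x p t (p (t + 1))) ≤
      √(T * ((1 + Cx ^ 2) * (d * Real.log (1 + T * Cx ^ 2)))) := by
  refine Real.le_sqrt_of_sq_le ?_
  refine sq_sum_le_card_mul_sum_sq.trans ?_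
  rw [Finset.card_range]
  refine mul_le_mul_of_nonneg_left ?_ (Nat.cast_nonneg T)
  refine le_trans (le_of_eq (Finset.sum_congr rfl fun t _ => ?_)) (sum_widthSq_le hβ hx hCx p T)
  exact Real.sq_sqrt (widthSq_nonneg (zero_lt_one.trans_le hβ) hx p t _)

theorem regret_le {Cθ Cη Lkey Δ Lnon μ δ : ℝ} {ρ : ℝ → ℕ} {T : ℕ} {p : ℕ → Fin (P + 1)}
    {η L : ℕ → ℝ} (hCθ : 0 ≤ Cθ) (hCη : 0 ≤ Cη) (hLkey : Lkey < 1) (hβ : 1 ≤ β) (hT : 1 ≤ T)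
    (hρ : IsRounding ρ) (hθ : ‖θ‖ ≤ Cθ) (hx : x (Fin.last P) = 0) (hCx : ∀ q, ‖x q‖ ≤ Cx)
    (hΔ : ∀ q, |expectedDelay df θ x q - expectedDelay df θ x (Fin.last P)| ≤ Δ)
    (hLnon : 0 < Lnon) (hLnk : Lnon < Lkey) (hL : ∀ t < T, L (t + 1) = Lnon ∨ L (t + 1) = Lkey)
    (hrun : IsRun T (forcedFrames ρ μ T) (explorationParam d Cθ Cη Cx Lkey β T δ) β df x L
      (fun t => inner ℝ θ (x (p t)) + η t) p)
    (hconf : ∀ t ≤ T, vecB x p η t ⬝ᵥ ((matA β x p t)⁻¹ *ᵥ vecB x p η t) ≤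
      Cη ^ 2 * (max (d : ℝ) 2 * Real.log ((1 + T * Cx ^ 2) / δ))) :
    regret df θ x p T ≤ 4 * Δ * (T : ℝ) ^ (1 - μ) +
      2 * explorationParam d Cθ Cη Cx Lkey β T δ *
        √(T * ((1 + Cx ^ 2) * (d * Real.log (1 + T * Cx ^ 2)))) := by
  classical
  have hβ0 := zero_lt_one.trans_le hβ
  have hΔ0 : 0 ≤ Δ := (abs_nonneg _).trans (hΔ 0)
  set r := Cη * √(max (d : ℝ) 2 * Real.log ((1 + T * Cx ^ 2) / δ))
  have hr : 0 ≤ r := by positivity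
  have hκ : 0 ≤ √β * Cθ + r := by positivity
  have hk : 0 < 1 - Lkey := by linarith
  have hα : 0 ≤ explorationParam d Cθ Cη Cx Lkey β T δ := div_nonneg hκ hk.le
  -- Forced frames are charged a width as well, so that the potential bound applies to the whole
  -- run.
  have hframe : ∀ t ∈ Finset.range T,
      expectedDelay df θ x (p (t + 1)) - oracleDelay df θ x ≤
        (if t + 1 ∈ forcedFrames ρ μ T then 2 * Δ else 0) +
          2 * explorationParam d Cθ Cη Cx Lkey β T δ * √(widthSq β x p t (p (t + 1))) := by
    intro t ht
    have htT := Finset.mem_range.1 ht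
    split_ifs with hF
    · have := expectedDelay_sub_oracleDelay_le hΔ (p (t + 1))
      have : 0 ≤ 2 * explorationParam d Cθ Cη Cx Lkey β T δ * √(widthSq β x p t (p (t + 1))) := by
        positivity
      linarith
    · rw [zero_add]
      refine expectedDelay_sub_oracleDelay_le_width hκ hLkey ?_ ?_ (fun q => ?_)
        (hrun.regular t htT hF)
      · rcases hL t htT with h | h <;> rw [h] <;> linarith
      · rcases hL t htT with h | h <;> rw [h]
        exact hLnk.le
      · refine abs_thetaHat_sub_le hβ0 hx p θ η t q hθ ?_
        refine (Real.sqrt_le_sqrt (hconf t htT.le)).trans (le_of_eq ?_)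
        rw [Real.sqrt_mul (sq_nonneg _), Real.sqrt_sq hCη]
  rw [regret_eq_sum_range]
  refine (Finset.sum_le_sum hframe).trans ?_
  rw [Finset.sum_add_distrib, ← Finset.mul_sum, ← Finset.sum_filter, Finset.sum_const,
    nsmul_eq_mul]
  have h1 := mul_le_mul_of_nonneg_right (card_forcedFrames_le hρ (μ := μ) hT)
    (by positivity : (0 : ℝ) ≤ 2 * Δ)
  have h2 := mul_le_mul_of_nonneg_left (sum_sqrt_widthSq_le hβ hx hCx p T)
    (by positivity : 0 ≤ 2 * explorationParam d Cθ Cη Cx Lkey β T δ)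
  linarith

/-- The constant in front of `√T log (T / δ)` in the regret of the frames without forced
sampling. -/
noncomputable def regretConst (d : ℕ) (Cθ Cη Cx Lkey β : ℝ) : ℝ :=
  2 * ((√β * Cθ / √(Real.log 2) +
    Cη * √(max (d : ℝ) 2 * (1 + Real.log (1 + Cx ^ 2) / Real.log 2))) / (1 - Lkey)) *
    √((1 + Cx ^ 2) * (d * (1 + Real.log (1 + Cx ^ 2) / Real.log 2)))

theorem regretConst_nonneg {Cθ Cη Lkey : ℝ} (hCθ : 0 ≤ Cθ) (hCη : 0 ≤ Cη) (hLkey : Lkey < 1) :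
    0 ≤ regretConst d Cθ Cη Cx Lkey β := by
  have hk : 0 < 1 - Lkey := by linarith
  unfold regretConst
  positivity

/-- For `T ≥ 2` the logarithm `N = log (T/δ)` is at least `log 2`, so additive constants can be
absorbed into multiples of `N`. Both factors then carry a `√N`. -/
theorem explorationParam_mul_sqrt_le {Cθ Cη Lkey δ : ℝ} {T : ℕ} (hCθ : 0 ≤ Cθ) (hCη : 0 ≤ Cη)
    (hLkey : Lkey < 1) (hT : 2 ≤ T) (hδ : 0 < δ) (hδ1 : δ < 1) :
    2 * explorationParam d Cθ Cη Cx Lkey β T δ *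
        √(T * ((1 + Cx ^ 2) * (d * Real.log (1 + T * Cx ^ 2)))) ≤
      regretConst d Cθ Cη Cx Lkey β * (√T * Real.log (T / δ)) := by
  have hk : 0 < 1 - Lkey := by linarith
  have hT2 : (2 : ℝ) ≤ T := by exact_mod_cast hT
  have hlog2 : 0 < Real.log 2 := Real.log_pos (by norm_num)
  have hTδ : (T : ℝ) ≤ T / δ := le_div_self (by linarith) hδ hδ1.le
  set N := Real.log (T / δ)
  have hN : Real.log 2 ≤ N := Real.log_le_log (by norm_num) (hT2.trans hTδ)
  have hN0 : 0 < N := hlog2.trans_le hN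
  have hCx2 : 0 ≤ Real.log (1 + Cx ^ 2) := Real.log_nonneg (by nlinarith [sq_nonneg Cx])
  set c := 1 + Real.log (1 + Cx ^ 2) / Real.log 2 with hc
  have hc0 : 0 ≤ c := by positivity
  have hlogδ : Real.log ((1 + T * Cx ^ 2) / δ) ≤ c * N := by
    have h1 : (1 + T * Cx ^ 2) / δ ≤ (1 + Cx ^ 2) * (T / δ) := by
      rw [mul_div_assoc']
      gcongr
      nlinarith [sq_nonneg Cx]
    have h2 := Real.log_le_log (by positivity) h1
    rw [Real.log_mul (by positivity) (by positivity)] at h2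
    have h3 : Real.log (1 + Cx ^ 2) ≤ Real.log (1 + Cx ^ 2) / Real.log 2 * N := by
      rw [div_mul_eq_mul_div, le_div_iff₀ hlog2]
      exact mul_le_mul_of_nonneg_left hN hCx2
    rw [hc, add_mul, one_mul]
    linarith
  have hlog : Real.log (1 + T * Cx ^ 2) ≤ c * N := by
    refine le_trans (Real.log_le_log (by positivity) ?_) hlogδ
    exact le_div_self (by positivity) hδ hδ1.le
  have h1 : explorationParam d Cθ Cη Cx Lkey β T δ ≤ (√β * Cθ / √(Real.log 2) +
      Cη * √(max (d : ℝ) 2 * c)) / (1 - Lkey) * √N := by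
    rw [explorationParam, div_mul_eq_mul_div]
    refine div_le_div_of_nonneg_right ?_ hk.le
    rw [add_mul]
    refine add_le_add ?_ ?_
    · rw [div_mul_eq_mul_div, le_div_iff₀ (Real.sqrt_pos.2 hlog2)]
      exact mul_le_mul_of_nonneg_left (Real.sqrt_le_sqrt hN) (by positivity)
    · rw [mul_assoc, ← Real.sqrt_mul (by positivity), mul_assoc]
      gcongr
  have h2 : √(T * ((1 + Cx ^ 2) * (d * Real.log (1 + T * Cx ^ 2)))) ≤
      √((1 + Cx ^ 2) * (d * c)) * (√T * √N) := by
    rw [← Real.sqrt_mul (Nat.cast_nonneg T), ← Real.sqrt_mul (by positivity)]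
    refine Real.sqrt_le_sqrt ?_
    calc (T : ℝ) * ((1 + Cx ^ 2) * (d * Real.log (1 + T * Cx ^ 2)))
        ≤ T * ((1 + Cx ^ 2) * (d * (c * N))) := by gcongr
      _ = (1 + Cx ^ 2) * (d * c) * (T * N) := by ring
  calc 2 * explorationParam d Cθ Cη Cx Lkey β T δ *
        √(T * ((1 + Cx ^ 2) * (d * Real.log (1 + T * Cx ^ 2))))
      ≤ 2 * ((√β * Cθ / √(Real.log 2) + Cη * √(max (d : ℝ) 2 * c)) / (1 - Lkey) * √N) *
        (√((1 + Cx ^ 2) * (d * c)) * (√T * √N)) := by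
        refine mul_le_mul (mul_le_mul_of_nonneg_left h1 (by norm_num)) h2 (Real.sqrt_nonneg _) ?_
        positivity
    _ = regretConst d Cθ Cη Cx Lkey β * (√T * (√N * √N)) := by rw [regretConst, ← hc]; ring
    _ = regretConst d Cθ Cη Cx Lkey β * (√T * N) := by rw [Real.mul_self_sqrt hN0.le]

theorem regret_le_regretRate {Cθ Cη Lkey Δ Lnon μ δ : ℝ} {ρ : ℝ → ℕ} {T : ℕ}
    {p : ℕ → Fin (P + 1)} {η L : ℕ → ℝ} (hCθ : 0 ≤ Cθ) (hCη : 0 ≤ Cη) (hLkey : Lkey < 1)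
    (hβ : 1 ≤ β) (hT : 1 ≤ T) (hμ : 0 ≤ μ) (hδ : 0 < δ) (hδ1 : δ < 1)
    (hρ : IsRounding ρ) (hθ : ‖θ‖ ≤ Cθ) (hx : x (Fin.last P) = 0) (hCx : ∀ q, ‖x q‖ ≤ Cx)
    (hΔ : ∀ q, |expectedDelay df θ x q - expectedDelay df θ x (Fin.last P)| ≤ Δ)
    (hLnon : 0 < Lnon) (hLnk : Lnon < Lkey) (hL : ∀ t < T, L (t + 1) = Lnon ∨ L (t + 1) = Lkey)
    (hrun : IsRun T (forcedFrames ρ μ T) (explorationParam d Cθ Cη Cx Lkey β T δ) β df x L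
      (fun t => inner ℝ θ (x (p t)) + η t) p)
    (hconf : ∀ t ≤ T, vecB x p η t ⬝ᵥ ((matA β x p t)⁻¹ *ᵥ vecB x p η t) ≤
      Cη ^ 2 * (max (d : ℝ) 2 * Real.log ((1 + T * Cx ^ 2) / δ))) :
    regret df θ x p T ≤
      (4 * |Δ| + regretConst d Cθ Cη Cx Lkey β + 1) * regretRate μ δ T := by
  have hΔ0 : 0 ≤ Δ := (abs_nonneg _).trans (hΔ 0)
  have hC := regretConst_nonneg (d := d) (Cx := Cx) (β := β) hCθ hCη hLkey
  have hT1 : (1 : ℝ) ≤ T := by exact_mod_cast hT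
  have hrate1 : (T : ℝ) ^ (1 - μ) ≤ regretRate μ δ T := le_max_right _ _
  have hrate2 : (T : ℝ) ^ (1 / 2 + μ) * Real.log (T / δ) ≤ regretRate μ δ T := le_max_left _ _
  have hrate0 : 0 < regretRate μ δ T := (Real.rpow_pos_of_pos (by linarith) _).trans_le hrate1
  rw [abs_of_nonneg hΔ0]
  -- At `T = 1` the logarithm `log (1/δ)` can be arbitrarily small; the single frame is paid for by
  -- `T^(1-μ) = 1`.
  rcases hT.eq_or_lt with rfl | hT2
  · have h1 : regret df θ x p 1 ≤ 2 * Δ := by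
      rw [regret, Finset.Icc_self, Finset.sum_singleton]
      exact expectedDelay_sub_oracleDelay_le hΔ _
    rw [Nat.cast_one, Real.one_rpow] at hrate1
    nlinarith [mul_nonneg hC hrate0.le, mul_le_mul_of_nonneg_left hrate1 hΔ0]
  · have h1 := regret_le hCθ hCη hLkey hβ hT hρ hθ hx hCx hΔ hLnon hLnk hL hrun hconf
    have h2 := explorationParam_mul_sqrt_le (d := d) (Cx := Cx) (β := β) hCθ hCη hLkey hT2 hδ hδ1
    have h3 : √(T : ℝ) * Real.log (T / δ) ≤ regretRate μ δ T := by
      refine le_trans (mul_le_mul_of_nonneg_right ?_ ?_) hrate2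
      · rw [Real.sqrt_eq_rpow]
        exact Real.rpow_le_rpow_of_exponent_le hT1 (by linarith)
      · exact Real.log_nonneg (hT1.trans (le_div_self (by linarith) hδ hδ1.le))
    have h4 := mul_le_mul_of_nonneg_left h3 hC
    have h5 := mul_le_mul_of_nonneg_left hrate1 (by positivity : 0 ≤ 4 * Δ)
    nlinarith

end Regret

/-! ### Asymptotics of the rate. -/

section Rate

theorem isLittleO_natCast_rpow {a b : ℝ} (h : a < b) :
    (fun T : ℕ => (T : ℝ) ^ a) =o[atTop] fun T : ℕ => (T : ℝ) ^ b := by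
  have htop : Tendsto (fun T : ℕ => (T : ℝ) ^ (b - a)) atTop atTop :=
    (tendsto_rpow_atTop (by linarith)).comp tendsto_natCast_atTop_atTop
  have h1 : (fun _ : ℕ => (1 : ℝ)) =o[atTop] fun T : ℕ => (T : ℝ) ^ (b - a) :=
    isLittleO_const_left.2 (Or.inr (tendsto_abs_atTop_atTop.comp htop))
  have h2 := (isBigO_refl (fun T : ℕ => (T : ℝ) ^ a) atTop).mul_isLittleO h1
  simp only [mul_one] at h2
  refine h2.congr' EventuallyEq.rfl ?_
  filter_upwards [eventually_ge_atTop 1] with T hT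
  have : (0 : ℝ) < T := by positivity
  rw [← Real.rpow_add this, add_sub_cancel]

theorem isBigO_log_div {δ : ℝ} (hδ : 0 < δ) :
    (fun T : ℕ => Real.log (T / δ)) =O[atTop] fun T : ℕ => Real.log (T : ℝ) := by
  have htop : Tendsto (fun T : ℕ => Real.log (T : ℝ)) atTop atTop :=
    Real.tendsto_log_atTop.comp tendsto_natCast_atTop_atTop
  have h1 : (fun T : ℕ => Real.log (T / δ)) =ᶠ[atTop]
      fun T : ℕ => Real.log (T : ℝ) - Real.log δ := by
    filter_upwards [eventually_ge_atTop 1] with T hT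
    have : (T : ℝ) ≠ 0 := by positivity
    exact Real.log_div this hδ.ne'
  refine h1.trans_isBigO ((isBigO_refl _ _).sub ?_)
  exact (isLittleO_const_left.2 (Or.inr (tendsto_abs_atTop_atTop.comp htop))).isBigO

theorem isLittleO_rpow_mul_log {a b δ : ℝ} (hδ : 0 < δ) (h : a < b) :
    (fun T : ℕ => (T : ℝ) ^ a * Real.log (T / δ)) =o[atTop] fun T : ℕ => (T : ℝ) ^ b := by
  have h1 : (fun T : ℕ => Real.log (T : ℝ)) =o[atTop] fun T : ℕ => (T : ℝ) ^ (b - a) :=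
    (isLittleO_log_rpow_atTop (by linarith)).comp_tendsto tendsto_natCast_atTop_atTop
  have h2 := (isBigO_refl (fun T : ℕ => (T : ℝ) ^ a) atTop).mul_isLittleO
    ((isBigO_log_div hδ).trans_isLittleO h1)
  refine h2.congr' EventuallyEq.rfl ?_
  filter_upwards [eventually_ge_atTop 1] with T hT
  have : (0 : ℝ) < T := by positivity
  rw [← Real.rpow_add this, add_sub_cancel]

theorem isBigO_one_log_div {δ : ℝ} (hδ : 0 < δ) :
    (fun _ : ℕ => (1 : ℝ)) =O[atTop] fun T : ℕ => Real.log (T / δ) := by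
  have htop : Tendsto (fun T : ℕ => Real.log (T / δ)) atTop atTop :=
    Real.tendsto_log_atTop.comp (tendsto_natCast_atTop_atTop.atTop_div_const hδ)
  exact (isLittleO_const_left.2 (Or.inr (tendsto_abs_atTop_atTop.comp htop))).isBigO

theorem abs_max_le (a b : ℝ) : |max a b| ≤ |a| + |b| := by
  rcases max_choice a b with h | h <;> rw [h] <;> linarith [abs_nonneg a, abs_nonneg b]

theorem isBigO_max_add (f g : ℕ → ℝ) :
    (fun T => max (f T) (g T)) =O[atTop] fun T => |f T| + |g T| :=
  IsBigO.of_bound 1 (Eventually.of_forall fun T => by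
    rw [one_mul, Real.norm_eq_abs, Real.norm_eq_abs]
    exact (abs_max_le _ _).trans (le_abs_self _))

theorem isLittleO_max {f g h : ℕ → ℝ} (hf : f =o[atTop] h) (hg : g =o[atTop] h) :
    (fun T => max (f T) (g T)) =o[atTop] h :=
  (isBigO_max_add f g).trans_isLittleO (hf.abs_left.add hg.abs_left)

theorem isBigO_max {f g h : ℕ → ℝ} (hf : f =O[atTop] h) (hg : g =O[atTop] h) :
    (fun T => max (f T) (g T)) =O[atTop] h :=
  (isBigO_max_add f g).trans (hf.abs_left.add hg.abs_left)

theorem tendsto_regretRate_div {μ δ : ℝ} (hμ : 0 < μ) (hμ2 : μ < 1 / 2) (hδ : 0 < δ) :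
    Tendsto (fun T : ℕ => regretRate μ δ T / (T : ℝ)) atTop (𝓝 0) := by
  have h : (fun T : ℕ => regretRate μ δ T) =o[atTop] fun T : ℕ => (T : ℝ) ^ (1 : ℝ) :=
    isLittleO_max (isLittleO_rpow_mul_log hδ (by linarith))
      (isLittleO_natCast_rpow (by linarith))
  simpa using h.tendsto_div_nhds_zero

theorem rpow_isBigO_rpow_mul_log (a : ℝ) {δ : ℝ} (hδ : 0 < δ) :
    (fun T : ℕ => (T : ℝ) ^ a) =O[atTop] fun T : ℕ => (T : ℝ) ^ a * Real.log (T / δ) := by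
  simpa using (isBigO_refl (fun T : ℕ => (T : ℝ) ^ a) atTop).mul (isBigO_one_log_div hδ)

theorem regretRate_quarter_isBigO {δ : ℝ} (hδ : 0 < δ) :
    (fun T : ℕ => regretRate (1 / 4) δ T) =O[atTop]
      fun T : ℕ => (T : ℝ) ^ (3 / 4 : ℝ) * Real.log (T / δ) := by
  unfold regretRate
  norm_num only
  exact isBigO_max (isBigO_refl _ _) (rpow_isBigO_rpow_mul_log _ hδ)

theorem regretRate_quarter_isBigO_log {δ : ℝ} (hδ : 0 < δ) :
    (fun T : ℕ => regretRate (1 / 4) δ T) =O[atTop]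
      fun T : ℕ => (T : ℝ) ^ (3 / 4 : ℝ) * Real.log T :=
  (regretRate_quarter_isBigO hδ).trans ((isBigO_refl _ _).mul (isBigO_log_div hδ))

/-- At `μ = 1/4` both exponents are `3/4`. Below it, `1 - μ > 3/4` beats the extra logarithm; above
it, `1/2 + μ > 3/4` and the logarithm occurs on both sides. -/
theorem regretRate_quarter_isLittleO {μ δ : ℝ} (hμ : μ ≠ 1 / 4) (hδ : 0 < δ) :
    (fun T : ℕ => regretRate (1 / 4) δ T) =o[atTop] fun T : ℕ => regretRate μ δ T := by
  refine (regretRate_quarter_isBigO hδ).trans_isLittleO ?_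
  have habs : ∀ {f g : ℕ → ℝ}, (∀ᶠ T in atTop, 0 ≤ f T) → (∀ T, f T ≤ g T) →
      f =O[atTop] g := fun {f g} h0 h =>
    IsBigO.of_bound 1 (h0.mono fun T hT => by
      rw [one_mul, Real.norm_of_nonneg hT]
      exact (h T).trans (le_abs_self _))
  rcases lt_or_gt_of_ne hμ with h | h
  · refine IsLittleO.trans_isBigO (isLittleO_rpow_mul_log hδ (b := 1 - μ) (by linarith)) ?_
    exact habs (Eventually.of_forall fun T => by positivity) fun T => le_max_right _ _
  · have h1 : (fun T : ℕ => (T : ℝ) ^ (3 / 4 : ℝ)) =o[atTop] fun T : ℕ => (T : ℝ) ^ (1 / 2 + μ) :=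
      isLittleO_natCast_rpow (by linarith)
    refine (h1.mul_isBigO (isBigO_refl (fun T : ℕ => Real.log (T / δ)) atTop)).trans_isBigO ?_
    have htop : Tendsto (fun T : ℕ => Real.log (T / δ)) atTop atTop :=
      Real.tendsto_log_atTop.comp (tendsto_natCast_atTop_atTop.atTop_div_const hδ)
    refine habs ?_ fun T => le_max_left _ _
    filter_upwards [htop.eventually_ge_atTop 0] with T hT
    positivity

end Rate

end MuLinUCB

theorem theorem1 (d : ℕ) (Cθ Cη Cx Lkey β Δ : ℝ)
    (hCθ : 0 ≤ Cθ) (hCη : 0 ≤ Cη) (hCx : 0 ≤ Cx) (hLkey : Lkey < 1)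
    (hβ : max 1 (Cθ ^ 2) ≤ β) :
    -- the regret bound; its constant depends only on `d, Cθ, Cη, Cx, Lkey, β, Δ`
    (∃ C : ℝ, 0 < C ∧
      ∀ (T : ℕ) (μ δ : ℝ), 1 ≤ T → 0 ≤ μ → 0 < δ → δ < 1 →
      ∀ (ρ : ℝ → ℕ), MuLinUCB.IsRounding ρ →
      ∀ (P : ℕ), 1 ≤ P →
      ∀ (df : Fin (P + 1) → ℝ) (θ : EuclideanSpace ℝ (Fin d))
        (x : Fin (P + 1) → EuclideanSpace ℝ (Fin d)),
        ‖θ‖ ≤ Cθ → (∀ q, ‖x q‖ ≤ Cx) → x (Fin.last P) = 0 →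
        (∀ q, |MuLinUCB.expectedDelay df θ x q
          - MuLinUCB.expectedDelay df θ x (Fin.last P)| ≤ Δ) →
      ∀ (Lnon : ℝ), 0 < Lnon → Lnon < Lkey →
      ∀ (Ω : Type*) (mΩ : MeasurableSpace Ω) (ℙ : Measure Ω) (_ : IsProbabilityMeasure ℙ)
        (ℱ : Filtration ℕ mΩ) (η L : ℕ → Ω → ℝ) (p : ℕ → Ω → Fin (P + 1)),
        MuLinUCB.IsSubGaussianNoise ℙ ℱ Cη T η →
        (∀ t < T, Measurable[ℱ t] (L (t + 1))) →
        (∀ t < T, ∀ ω, L (t + 1) ω = Lnon ∨ L (t + 1) ω = Lkey) →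
        (∀ t < T, Measurable[ℱ t] (p (t + 1))) →
        (∀ ω, MuLinUCB.IsRun T (MuLinUCB.forcedFrames ρ μ T)
          (MuLinUCB.explorationParam d Cθ Cη Cx Lkey β T δ) β df x (fun t => L t ω)
          (fun t => inner ℝ θ (x (p t ω)) + η t ω) (fun t => p t ω)) →
        ENNReal.ofReal (1 - δ) ≤
          ℙ {ω | MuLinUCB.regret df θ x (fun t => p t ω) T ≤ C * MuLinUCB.regretRate μ δ T}) ∧
    -- the bound is sublinear in `T` for `0 < μ < 1 / 2`
    (∀ μ δ : ℝ, 0 < μ → μ < 1 / 2 → 0 < δ → δ < 1 →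
      Tendsto (fun T : ℕ => MuLinUCB.regretRate μ δ T / (T : ℝ)) atTop (𝓝 0)) ∧
    -- for `μ = 1 / 4` it is of order `T^(3/4) log T`
    (∀ δ : ℝ, 0 < δ → δ < 1 →
      (fun T : ℕ => MuLinUCB.regretRate (1 / 4) δ T)
        =O[atTop] fun T : ℕ => (T : ℝ) ^ (3 / 4 : ℝ) * Real.log T) ∧
    -- and no other `μ` gives an order as small
    (∀ μ δ : ℝ, μ ≠ 1 / 4 → 0 < δ → δ < 1 →
      (fun T : ℕ => MuLinUCB.regretRate (1 / 4) δ T)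
        =o[atTop] fun T : ℕ => MuLinUCB.regretRate μ δ T) := by
  have hβ1 : 1 ≤ β := (le_max_left _ _).trans hβ
  have hC := MuLinUCB.regretConst_nonneg (d := d) (Cx := Cx) (β := β) hCθ hCη hLkey
  -- The constant is fixed before any instance forces `Δ ≥ 0`, hence `|Δ|`; the `+ 1` makes it
  -- strictly positive.
  refine ⟨⟨4 * |Δ| + MuLinUCB.regretConst d Cθ Cη Cx Lkey β + 1, by positivity, ?_⟩,
    fun μ δ hμ hμ2 hδ _ => MuLinUCB.tendsto_regretRate_div hμ hμ2 hδ,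
    fun δ hδ _ => MuLinUCB.regretRate_quarter_isBigO_log hδ,
    fun μ δ hμ hδ _ => MuLinUCB.regretRate_quarter_isLittleO hμ hδ⟩
  intro T μ δ hT hμ hδ hδ1 ρ hρ P _ df θ x hθ hxC hx hΔ Lnon hLnon hLnk Ω mΩ ℙ _ ℱ η L p hη _ hL
    hp hrun
  refine (MuLinUCB.ofReal_le_measure_confidence (β := β) hβ1 hCη hx hxC hη hp hδ hδ1).trans
    (measure_mono fun ω hω => ?_)
  exact MuLinUCB.regret_le_regretRate hCθ hCη hLkey hβ1 hT hμ hδ hδ1 hρ hθ hx hxC hΔ hLnon hLnk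
    (fun t ht => hL t ht ω) (hrun ω) hω
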